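/- **Setting.** Let $\mathcal S,\mathcal A$ be finite non-empty sets of sizes $S,A$, let $H,m,K\ge 1$, let $s_{\mathrm{init}}\in\mathcal S$, let $p=(p_h(\cdot\mid s,a))_{h\in[H]}$ be a known transition function, and let $c^1,\dots,c^K\in[0,1]^{HSA}$ be arbitrary cost functions fixed in advance (an oblivious adversary). In each episode $k$, agents $v=1,\dots,m$ start in $s_{\mathrm{init}}$, and given their policies they generate independent trajectories $(s^{k,v}_h,a^{k,v}_h)_{h\le H}$ with $a^{k,v}_h\sim\pi^{k,v}_h(\cdot\mid s^{k,v}_h)$ and $s^{k,v}_{h+1}\sim p_h(\cdot\mid s^{k,v}_h,a^{k,v}_h)$ (fresh randomness). For a policy $\pi$ let $q^\pi_h(s,a)=\Pr[s_h=s,a_h=a]$ be its occupancy measure, let $\Delta(\mathcal M)=\{q^\pi\}$ be the set of occupancy measures of all stochastic policies, let $\langle q,c\rangle=\sum_{h,s,a}q_h(s,a)c_h(s,a)$, and let $V^{k,\pi}$ be the expected total cost of $\pi$ in one episode under $c^k$. Write $\mathrm{KL}(q\,\|\,r)=\sum_{h,s,a}q_h(s,a)\log\frac{q_h(s,a)}{r_h(s,a)}$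 ($+\infty$ unless $q\ll r$). **Algorithm (coop-O-REPS, parameters $\eta,\gamma$).** Entropy-regularized online mirror descent over $\Delta(\mathcal M)$: start from the regularizer's minimizer $q^1=\arg\min_{q\in\Delta(\mathcal M)}\sum_{h,s,a}q_h(s,a)\log q_h(s,a)$ (equivalently, the KL projection of the uniform measure $1/(SA)$ onto $\Delta(\mathcal M)$). In episode $k$ every agent plays $\pi^k_h(a\mid s)=q^k_h(s,a)/\sum_{a'}q^k_h(s,a')$ (uniform where the denominator vanishes). Then compute $$W^k_h(s,a)=1-(1-q^k_h(s,a))^m,\qquad \hat c^k_h(s,a)=\frac{c^k_h(s,a)\,\mathbf 1\{\exists v:\ s^{k,v}_h=s,\ a^{k,v}_h=a\}}{W^k_h(s,a)+\gamma},$$ $$q^{k+1}=\arg\min_{q\in\Delta(\mathcal M)}\ \eta\langle q,\hat c^k\rangle+\mathrm{KL}(q\,\|\,q^k).$$ **Theorem.** There is a universal constant $C>0$ such that, in every such setting and for every $\delta\in(0,1)$, when coop-O-REPS is run with $$\eta=\gamma=\sqrt{\frac{\log\frac{HSA}{\delta}}{\left(1+\frac{SA}{m}\right)K}},$$ $W^k_h(s,a)$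 is the probability, given the past episodes, that some agent visits $(s,a)$ at step $h$ of episode $k$, and with probability at least $1-\delta$ every agent $v\in[m]$ has pseudo-regret $$\sum_{k=1}^K V^{k,\pi^{k,v}}-\min_\pi\sum_{k=1}^K V^{k,\pi}\ \le\ C\left(H\sqrt{K\log\tfrac{HSA}{\delta}}+\sqrt{\tfrac{H^2SAK}{m}\log\tfrac{HSA}{\delta}}+\tfrac{HSA}{m}\log\tfrac{HSA}{\delta}\right),$$ where $\pi^{k,v}=\pi^k$. -/

import Mathlib

open scoped ENNReal

/-- A (stochastic, time-dependent) policy: `π h s` is the law of the action taken in state `s`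
at step `h`. Steps are indexed by `Fin H`. -/
abbrev Policy (H : ℕ) (S A : Type*) := Fin H → S → PMF A

/-- A transition function: `p h s a` is the law of the next state. -/
abbrev Transition (H : ℕ) (S A : Type*) := Fin H → S → A → PMF S

/-- Real functions on step-state-action triples: cost functions and occupancy measures. -/
abbrev StepFun (H : ℕ) (S A : Type*) := Fin H → S → A → ℝ

/-- The state-action pairs met by one agent in one episode. -/
abbrev Traj (H : ℕ) (S A : Type*) := Fin H → S × A

/-- The trajectories of all `m` agents in one episode. -/
abbrev TeamTraj (m H : ℕ) (S A : Type*) := Fin m → Traj H S A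

namespace CoopMDP

/-- The probability of an event under a probability mass function, as a real number. -/
noncomputable def prob {α : Type*} (P : PMF α) (E : Set α) : ℝ := (P.toOuterMeasure E).toReal

/-- The independent product of finitely many probability mass functions on a finite type. -/
noncomputable def indepProd {ι α : Type*} [Fintype ι] [DecidableEq ι] [Fintype α]
    (P : ι → PMF α) : PMF (ι → α) :=
  PMF.ofFintype (fun x => ∏ i, P i (x i)) (by
    have h := Finset.prod_univ_sum (fun _ : ι => (Finset.univ : Finset α)) (fun i a => P i a)
    rw [Fintype.piFinset_univ] at h
    rw [← h]
    refine Finset.prod_eq_one fun i _ => ?_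
    have := (P i).tsum_coe
    rwa [tsum_fintype] at this)

/-- The law of the trajectory of an agent that starts in `s` and plays `π`: draw `a ∼ π₁(·|s)`,
draw the next state from `p₁(·|s,a)`, and go on from there with the remaining steps. -/
noncomputable def trajLaw {S A : Type*} :
    {H : ℕ} → Transition H S A → Policy H S A → S → PMF (Traj H S A)
  | 0, _, _, _ => PMF.pure Fin.elim0
  | _ + 1, p, π, s =>
      (π 0 s).bind fun a =>
        (p 0 s a).bind fun s' =>
          (trajLaw (fun h => p h.succ) (fun h => π h.succ) s').map fun τ =>
            Fin.cons (α := fun _ => S × A) (s, a) τ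

section Single

variable {H : ℕ} {S A : Type*}

/-- The value `V₁^π(s₀)` under the cost function `c`: the expected total cost of an episode. -/
noncomputable def value [Fintype S] [Fintype A] (p : Transition H S A) (s₀ : S)
    (c : StepFun H S A) (π : Policy H S A) : ℝ :=
  ∑ τ : Traj H S A, (trajLaw p π s₀ τ).toReal * ∑ h, c h (τ h).1 (τ h).2

/-- The occupancy measure `q^π_h(s,a) = Pr[s_h = s, a_h = a]`. -/
noncomputable def occ (p : Transition H S A) (s₀ : S) (π : Policy H S A) : StepFun H S A :=
  fun h s a => prob (trajLaw p π s₀) {τ | τ h = (s, a)}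

/-- The set `Δ(M)` of the occupancy measures of all stochastic policies. -/
def occSet (p : Transition H S A) (s₀ : S) : Set (StepFun H S A) :=
  Set.range (occ p s₀)

/-- `⟨q, c⟩`. -/
noncomputable def pairing [Fintype S] [Fintype A] (q c : StepFun H S A) : ℝ :=
  ∑ h, ∑ s, ∑ a, q h s a * c h s a

/-- `q ≪ r`, that is, `KL(q ‖ r)` is finite. -/
def AbsCont (q r : StepFun H S A) : Prop := ∀ h s a, r h s a = 0 → q h s a = 0

/-- The value of `KL(q ‖ r) = ∑ q log (q / r)` when `q ≪ r`. Otherwise `KL(q ‖ r)` is `+∞`, and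
`klDiv` is not used. -/
noncomputable def klDiv [Fintype S] [Fintype A] (q r : StepFun H S A) : ℝ :=
  ∑ h, ∑ s, ∑ a, q h s a * Real.log (q h s a / r h s a)

/-- `q` minimizes `η ⟨q, ĉ⟩ + KL(q ‖ r)` over `Δ(M)`. Points where the divergence is `+∞` are
not minimizers and need not be compared with. -/
def IsOMDStep [Fintype S] [Fintype A] (p : Transition H S A) (s₀ : S) (η : ℝ)
    (chat r q : StepFun H S A) : Prop :=
  (q ∈ occSet p s₀ ∧ AbsCont q r) ∧
    ∀ q' ∈ occSet p s₀, AbsCont q' r →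
      η * pairing q chat + klDiv q r ≤ η * pairing q' chat + klDiv q' r

/-- `argmin_{q ∈ Δ(M)} η ⟨q, ĉ⟩ + KL(q ‖ r)`. -/
noncomputable def omdStep [Fintype S] [Fintype A] (p : Transition H S A) (s₀ : S) (η : ℝ)
    (chat r : StepFun H S A) : StepFun H S A :=
  Classical.epsilon (IsOMDStep p s₀ η chat r)

open Classical in
/-- The policy `π_h(a|s) = q_h(s,a) / ∑_{a'} q_h(s,a')` of an occupancy measure. In a state that is
never visited at step `h` (where the quotient is `0/0`) it plays the uniform law. -/
noncomputable def policyOf [Fintype A] [Nonempty A] (q : StepFun H S A) : Policy H S A :=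
  fun h s =>
    if hq : ∑' a, ENNReal.ofReal (q h s a) = 0 then PMF.uniformOfFintype A
    else PMF.normalize (fun a => ENNReal.ofReal (q h s a)) hq (by
      rw [tsum_fintype]
      exact ENNReal.sum_ne_top.2 fun _ _ => ENNReal.ofReal_ne_top)

/-- `W_h(s,a) = 1 - (1 - q_h(s,a))^m`. -/
noncomputable def visitProb (m : ℕ) (q : StepFun H S A) : StepFun H S A :=
  fun h s a => 1 - (1 - q h s a) ^ m

open Classical in
/-- The estimator `ĉ_h(s,a) = c_h(s,a) 1{∃ v, s^v_h = s, a^v_h = a} / (W_h(s,a) + γ)`. It uses the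
costs of visited pairs only, which the team has observed. -/
noncomputable def estimator {m : ℕ} (γ : ℝ) (q c : StepFun H S A) (e : TeamTraj m H S A) :
    StepFun H S A :=
  fun h s a =>
    c h s a * (if ∃ v, e v h = (s, a) then 1 else 0) / (visitProb m q h s a + γ)

end Single

section Team

variable {m H : ℕ} {S A : Type*}

/-- An algorithm for a team of `m` agents: from the trajectories of the episodes `0, …, k - 1` it
computes the policy that each agent plays in episode `k`. -/
abbrev TeamAlg (m H : ℕ) (S A : Type*) :=
  (k : ℕ) → (Fin k → TeamTraj m H S A) → Fin m → Policy H S A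

/-- Fresh randomness: given their policies, the agents' trajectories in an episode are
independent. -/
noncomputable def episodeLaw [Fintype S] [Fintype A] (p : Transition H S A) (s₀ : S)
    (π : Fin m → Policy H S A) : PMF (TeamTraj m H S A) :=
  indepProd fun v => trajLaw p (π v) s₀

/-- The law of the trajectories of the first `K` episodes when the team runs `alg`. -/
noncomputable def runLaw [Fintype S] [Fintype A] (p : Transition H S A) (s₀ : S)
    (alg : TeamAlg m H S A) : (K : ℕ) → PMF (Fin K → TeamTraj m H S A)
  | 0 => PMF.pure Fin.elim0
  | K + 1 =>
      (runLaw p s₀ alg K).bind fun hist =>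
        (episodeLaw p s₀ (alg K hist)).map fun e =>
          Fin.snoc (α := fun _ => TeamTraj m H S A) hist e

/-- The policy of agent `v` in episode `k` of a run of `K` episodes. -/
def played (alg : TeamAlg m H S A) {K : ℕ} (hist : Fin K → TeamTraj m H S A) (v : Fin m)
    (k : Fin K) : Policy H S A :=
  alg k (fun j => hist (Fin.castLE k.isLt.le j)) v

/-- The pseudo-regret of agent `v` over a run of `K` episodes, where `c k` is the cost function of
episode `k`. -/
noncomputable def regret [Fintype S] [Fintype A] (p : Transition H S A) (s₀ : S)
    (c : ℕ → StepFun H S A) (alg : TeamAlg m H S A) {K : ℕ} (hist : Fin K → TeamTraj m H S A)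
    (v : Fin m) : ℝ :=
  ∑ k : Fin K, value p s₀ (c k) (played alg hist v k)
    - ⨅ π : Policy H S A, ∑ k : Fin K, value p s₀ (c k) π

/-- The iterate `q^k` of coop-O-REPS as a function of the past episodes. The first one is the
entropy-maximizing occupancy measure, written as the divergence projection of the uniform measure
`1 / (S A)` onto `Δ(M)`. -/
noncomputable def orepsIterate [Fintype S] [Fintype A] (p : Transition H S A) (s₀ : S)
    (c : ℕ → StepFun H S A) (η γ : ℝ) :
    (k : ℕ) → (Fin k → TeamTraj m H S A) → StepFun H S A
  | 0, _ =>
      omdStep p s₀ η (fun _ _ _ => 0)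
        (fun _ _ _ => 1 / ((Fintype.card S : ℝ) * (Fintype.card A : ℝ)))
  | k + 1, hist =>
      let q := orepsIterate p s₀ c η γ k (fun j => hist j.castSucc)
      omdStep p s₀ η (estimator γ q (c k) (hist (Fin.last k))) q

/-- coop-O-REPS: in episode `k` all agents play the policy of `q^k`. -/
noncomputable def coopOREPS [Fintype S] [Fintype A] [Nonempty A] (p : Transition H S A) (s₀ : S)
    (c : ℕ → StepFun H S A) (η γ : ℝ) : TeamAlg m H S A :=
  fun k hist _ => policyOf (orepsIterate p s₀ c η γ k hist)

end Team

end CoopMDP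

/-!
The regret of coop-O-REPS is that of mirror descent on estimated costs plus two estimation errors:
with `q` the iterate of an episode, `ĉ` the estimator, and `y` the occupancy measure of a
comparator,
`⟨q - y, c⟩ = ⟨q, c - ĉ⟩ + ⟨q - y, ĉ⟩ + ⟨y, ĉ - c⟩`.

The occupancy measures are exactly the solutions of the flow constraints (`mem_occSet_iff`), a
compact convex set on which the policy read off from `q` has occupancy measure `q`. Hence the
mirror descent steps exist, and all agents together visit a pair with probability
`W = 1 - (1 - q)^m`. The cooperation gain is the inequality `q / W ≤ 1 / m + q`
(`le_mul_visitProb`).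

* The middle term is the regret of entropic mirror descent (`orepsIterate_regret_le`). Because the
  derivative of the entropy is `-∞` at the boundary, an iterate charges every triple that some
  occupancy measure charges, so the first-order condition holds at the iterate
  (`first_order_of_segment_min`) and gives the usual telescoping inequality with local-norm term
  `∑ q ĉ² ≤ ∑ (1 / m + q) ĉ`.
* The loss `⟨q, ĉ⟩` is at most `2 H` surely, since at most `m` pairs are visited per step and each
  contributes at most `1 / m + q` (`pairing_estimator_le`). Its fluctuation is controlled by an
  exponential moment, and the bias of `ĉ` costs `γ ∑ (1 / m + q)`.
* Implicit exploration gives `E exp (γ ĉ - γ c) ≤ 1` pair by pair (`expect_exp_estimator_le`), so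
  by a union bound over the triples `∑ ĉ ≤ ∑ c + log (2 H S A / δ) / γ` simultaneously for all of
  them. This bounds the last term for all comparators `y` at once, so no minimizing policy has to
  be fixed beforehand, and also the part `(1 / m) ∑ ĉ` of the local-norm term.

Conditional exponential moments at most `1` multiply along a run (`expect_exp_sum_le_one`), and
Markov's inequality turns them into tail bounds.
-/

namespace CoopMDP

/-! ### Expectations over finite probability spaces -/

/-- The expectation of a real function under a probability mass function on a finite type. -/
noncomputable def expect {α : Type*} [Fintype α] (P : PMF α) (f : α → ℝ) : ℝ :=
  ∑ x, (P x).toReal * f x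

section Expect

variable {α β : Type*} [Fintype α] [Fintype β]

lemma sum_toReal_eq_one (P : PMF α) : ∑ x, (P x).toReal = 1 := by
  have h := P.tsum_coe
  rw [tsum_fintype] at h
  rw [← ENNReal.toReal_sum fun x _ => P.apply_ne_top x, h, ENNReal.toReal_one]

lemma expect_const (P : PMF α) (r : ℝ) : expect P (fun _ => r) = r := by
  rw [expect, ← Finset.sum_mul, sum_toReal_eq_one, one_mul]

lemma expect_add (P : PMF α) (f g : α → ℝ) :
    expect P (fun x => f x + g x) = expect P f + expect P g := by
  simp only [expect, mul_add, Finset.sum_add_distrib]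

lemma expect_sub (P : PMF α) (f g : α → ℝ) :
    expect P (fun x => f x - g x) = expect P f - expect P g := by
  simp only [expect, mul_sub, Finset.sum_sub_distrib]

lemma expect_const_mul (P : PMF α) (r : ℝ) (f : α → ℝ) :
    expect P (fun x => r * f x) = r * expect P f := by
  simp only [expect, Finset.mul_sum]
  exact Finset.sum_congr rfl fun x _ => by ring

lemma expect_sum {ι : Type*} (P : PMF α) (s : Finset ι) (f : ι → α → ℝ) :
    expect P (fun x => ∑ i ∈ s, f i x) = ∑ i ∈ s, expect P (f i) := by
  simp only [expect, Finset.mul_sum]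
  exact Finset.sum_comm

lemma expect_mono (P : PMF α) {f g : α → ℝ} (h : ∀ x, f x ≤ g x) : expect P f ≤ expect P g :=
  Finset.sum_le_sum fun x _ => mul_le_mul_of_nonneg_left (h x) ENNReal.toReal_nonneg

lemma expect_pure (x : α) (f : α → ℝ) : expect (PMF.pure x) f = f x := by
  classical
  rw [expect, Finset.sum_eq_single x]
  · simp
  · intro y _ hy
    simp [hy]
  · simp

lemma expect_bind (P : PMF α) (Q : α → PMF β) (f : β → ℝ) :
    expect (P.bind Q) f = expect P (fun x => expect (Q x) f) := by
  have h : ∀ y, (P.bind Q y).toReal = ∑ x, (P x).toReal * (Q x y).toReal := by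
    intro y
    rw [PMF.bind_apply, tsum_fintype, ENNReal.toReal_sum fun x _ =>
      ENNReal.mul_ne_top (P.apply_ne_top x) ((Q x).apply_ne_top y)]
    simp only [ENNReal.toReal_mul]
  simp only [expect, h, Finset.sum_mul, Finset.mul_sum]
  rw [Finset.sum_comm]
  exact Finset.sum_congr rfl fun x _ => Finset.sum_congr rfl fun y _ => by ring

lemma expect_map (P : PMF α) (g : α → β) (f : β → ℝ) :
    expect (P.map g) f = expect P (fun x => f (g x)) := by
  rw [← PMF.bind_pure_comp, expect_bind]
  simp only [Function.comp_apply, expect_pure]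

open Classical in
lemma prob_eq_expect (P : PMF α) (E : Set α) :
    prob P E = expect P (fun x => if x ∈ E then 1 else 0) := by
  rw [prob, PMF.toOuterMeasure_apply_fintype, ENNReal.toReal_sum]
  · refine Finset.sum_congr rfl fun x _ => ?_
    by_cases hx : x ∈ E <;> simp [hx]
  · intro x _
    by_cases hx : x ∈ E <;> simp [hx, P.apply_ne_top]

lemma prob_nonneg {α : Type*} (P : PMF α) (E : Set α) : 0 ≤ prob P E := ENNReal.toReal_nonneg

lemma prob_le_one (P : PMF α) (E : Set α) : prob P E ≤ 1 := by
  classical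
  rw [prob_eq_expect]
  refine (expect_mono P (g := fun _ => 1) fun x => ?_).trans_eq (expect_const P 1)
  split_ifs <;> norm_num

lemma prob_univ (P : PMF α) : prob P Set.univ = 1 := by
  simp [prob_eq_expect, expect_const]

/-- A set whose complement is covered by finitely many events of small probability. -/
lemma one_sub_sum_prob_le {ι : Type*} [Fintype ι] (P : PMF α) (G : Set α) (B : ι → Set α)
    (h : ∀ x, x ∉ G → ∃ i, x ∈ B i) : 1 - ∑ i, prob P (B i) ≤ prob P G := by
  classical
  simp only [prob_eq_expect]
  rw [← expect_sum]
  nth_rewrite 1 [← expect_const P 1]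
  rw [← expect_sub]
  refine expect_mono P fun x => ?_
  have hnn : ∀ i ∈ Finset.univ, (0 : ℝ) ≤ if x ∈ B i then 1 else 0 := fun i _ => by
    split_ifs <;> norm_num
  by_cases hx : x ∈ G
  · have := Finset.sum_nonneg hnn
    simp only [hx, if_true]
    linarith
  · obtain ⟨i, hi⟩ := h x hx
    have := Finset.single_le_sum hnn (Finset.mem_univ i)
    simp only [hx, hi, if_true, if_false] at this ⊢
    linarith

/-- Markov's inequality for the exponential of a random variable. -/
lemma prob_lt_le_exp_neg (P : PMF α) (Y : α → ℝ) (b : ℝ)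
    (hY : expect P (fun x => Real.exp (Y x)) ≤ 1) :
    prob P {x | b < Y x} ≤ Real.exp (-b) := by
  classical
  have h : prob P {x | b < Y x} ≤ Real.exp (-b) * expect P (fun x => Real.exp (Y x)) := by
    rw [prob_eq_expect, ← expect_const_mul]
    refine expect_mono P fun x => ?_
    rw [← Real.exp_add]
    split_ifs with hx
    · have hx' : b < Y x := hx
      exact Real.one_le_exp (by linarith)
    · exact (Real.exp_pos _).le
  exact h.trans (mul_le_of_le_one_right (Real.exp_pos _).le hY)

lemma expect_indepProd_prod {ι : Type*} [Fintype ι] [DecidableEq ι] (P : ι → PMF α)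
    (f : ι → α → ℝ) :
    expect (indepProd P) (fun x => ∏ i, f i (x i)) = ∏ i, expect (P i) (f i) := by
  simp only [expect, indepProd, PMF.ofFintype_apply, ENNReal.toReal_prod,
    ← Finset.prod_mul_distrib]
  rw [Finset.prod_univ_sum, Fintype.piFinset_univ]

end Expect

/-! ### Occupancy measures -/

section Occupancy

variable {S A : Type*} [Fintype S] [Fintype A]

lemma expect_trajLaw_succ {n : ℕ} (p : Transition (n + 1) S A) (π : Policy (n + 1) S A) (s : S)
    (f : Traj (n + 1) S A → ℝ) :
    expect (trajLaw p π s) f =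
      expect (π 0 s) fun a => expect (p 0 s a) fun s' =>
        expect (trajLaw (fun h => p h.succ) (fun h => π h.succ) s') fun τ =>
          f (Fin.cons (α := fun _ => S × A) (s, a) τ) := by
  simp only [trajLaw, expect_bind, expect_map]

open Classical in
lemma occ_eq_expect {H : ℕ} (p : Transition H S A) (s₀ : S) (π : Policy H S A) (h : Fin H)
    (s : S) (a : A) :
    occ p s₀ π h s a = expect (trajLaw p π s₀) (fun τ => if τ h = (s, a) then 1 else 0) := by
  rw [occ, prob_eq_expect]
  congr 1; ext τ
  congr

open Classical in
lemma occ_zero {n : ℕ} (p : Transition (n + 1) S A) (s₀ : S) (π : Policy (n + 1) S A)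
    (s : S) (a : A) :
    occ p s₀ π 0 s a = if s = s₀ then (π 0 s₀ a).toReal else 0 := by
  rw [occ_eq_expect, expect_trajLaw_succ]
  simp only [Fin.cons_zero, expect_const, Prod.mk.injEq]
  by_cases hs : s = s₀
  · subst hs
    simp [expect]
  · simp [hs, Ne.symm hs, expect_const, eq_comm]

lemma occ_succ {n : ℕ} (p : Transition (n + 1) S A) (s₀ : S) (π : Policy (n + 1) S A)
    (h : Fin n) (s : S) (a : A) :
    occ p s₀ π h.succ s a =
      expect (π 0 s₀) fun a' => expect (p 0 s₀ a') fun s' =>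
        occ (fun h => p h.succ) s' (fun h => π h.succ) h s a := by
  classical
  rw [occ_eq_expect, expect_trajLaw_succ]
  simp only [Fin.cons_succ, occ_eq_expect]

/-- The action played in a state is independent of how the state was reached. -/
lemma occ_eq_sum_mul {H : ℕ} (p : Transition H S A) (s₀ : S) (π : Policy H S A) (h : Fin H)
    (s : S) (a : A) :
    occ p s₀ π h s a = (∑ a', occ p s₀ π h s a') * (π h s a).toReal := by
  classical
  induction H generalizing s₀ with
  | zero => exact h.elim0
  | succ n ih =>
    refine Fin.cases ?_ (fun h => ?_) h
    · simp only [occ_zero]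
      by_cases hs : s = s₀
      · simp [hs, sum_toReal_eq_one]
      · simp [hs]
    · simp only [occ_succ]
      rw [← expect_sum, mul_comm, ← expect_const_mul]
      congr 1; ext a'
      rw [← expect_sum, ← expect_const_mul]
      congr 1; ext s'
      rw [mul_comm]
      exact ih _ _ _ h

/-- The linear constraints that cut out the occupancy measures: nonnegativity, the initial state,
and conservation of mass from each step to the next. Steps are written as natural numbers with a
bound, so that no case distinction on the horizon is needed. -/
structure IsFlow {H : ℕ} (p : Transition H S A) (s₀ : S) (q : StepFun H S A) : Prop where
  nonneg : ∀ h s a, 0 ≤ q h s a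
  init : ∀ (h0 : 0 < H) (s : S),
    ∑ a, q ⟨0, h0⟩ s a = Set.indicator {s₀} (fun _ => (1 : ℝ)) s
  step : ∀ (i : ℕ) (hi : i + 1 < H) (s' : S),
    ∑ a, q ⟨i + 1, hi⟩ s' a =
      ∑ s, ∑ a, q ⟨i, Nat.lt_of_succ_lt hi⟩ s a * (p ⟨i, Nat.lt_of_succ_lt hi⟩ s a s').toReal

lemma sum_occ_zero {n : ℕ} (p : Transition (n + 1) S A) (s₀ : S) (π : Policy (n + 1) S A)
    (s : S) : ∑ a, occ p s₀ π 0 s a = Set.indicator {s₀} (fun _ => (1 : ℝ)) s := by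
  classical
  simp only [occ_zero]
  by_cases hs : s = s₀
  · simp [hs, sum_toReal_eq_one]
  · simp [hs]

lemma sum_occ_succ {H : ℕ} (p : Transition H S A) (s₀ : S) (π : Policy H S A) (i : ℕ)
    (hi : i + 1 < H) (s' : S) :
    ∑ a, occ p s₀ π ⟨i + 1, hi⟩ s' a =
      ∑ s, ∑ a, occ p s₀ π ⟨i, Nat.lt_of_succ_lt hi⟩ s a *
        (p ⟨i, Nat.lt_of_succ_lt hi⟩ s a s').toReal := by
  classical
  induction i generalizing H s₀ with
  | zero =>
    obtain ⟨n, rfl⟩ : ∃ n, H = n + 2 := ⟨H - 2, by omega⟩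
    have h1 : (⟨0 + 1, hi⟩ : Fin (n + 2)) = (0 : Fin (n + 1)).succ := rfl
    have h0 : (⟨0, Nat.lt_of_succ_lt hi⟩ : Fin (n + 2)) = 0 := rfl
    rw [h1, h0]
    simp only [occ_succ, occ_zero]
    rw [← expect_sum, Finset.sum_eq_single s₀ (fun s _ hs => by simp [hs]) (by simp)]
    simp only [if_true]
    refine Finset.sum_congr rfl fun a _ => ?_
    beta_reduce
    rw [← expect_sum]
    congr 1
    rw [expect, Finset.sum_eq_single s']
    · simp [sum_toReal_eq_one]
    · intro s _ hs
      simp [hs.symm]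
    · simp
  | succ i ih =>
    obtain ⟨n, rfl⟩ : ∃ n, H = n + 1 := ⟨H - 1, by omega⟩
    have h1 : (⟨i + 1 + 1, hi⟩ : Fin (n + 1)) = (⟨i + 1, by omega⟩ : Fin n).succ := rfl
    have h0 : (⟨i + 1, Nat.lt_of_succ_lt hi⟩ : Fin (n + 1)) = (⟨i, by omega⟩ : Fin n).succ := rfl
    rw [h1, h0]
    simp only [occ_succ]
    simp only [mul_comm _ (p _ _ _ s').toReal, ← expect_const_mul, ← expect_sum]
    congr 1; ext a
    congr 1; ext s
    rw [ih (fun h => p h.succ) s (fun h => π h.succ) (by omega)]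
    simp only [mul_comm]

lemma isFlow_occ {H : ℕ} (p : Transition H S A) (s₀ : S) (π : Policy H S A) :
    IsFlow p s₀ (occ p s₀ π) where
  nonneg _ _ _ := prob_nonneg _ _
  init h0 s := by
    obtain ⟨n, rfl⟩ : ∃ n, H = n + 1 := ⟨H - 1, by omega⟩
    exact sum_occ_zero p s₀ π s
  step i hi s' := sum_occ_succ p s₀ π i hi s'

omit [Fintype S] in
lemma sum_mul_policyOf [Nonempty A] {H : ℕ} {q : StepFun H S A} (hq : ∀ h s a, 0 ≤ q h s a)
    (h : Fin H) (s : S) (a : A) :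
    (∑ a', q h s a') * (policyOf q h s a).toReal = q h s a := by
  have hsum : ∑' a, ENNReal.ofReal (q h s a) = ENNReal.ofReal (∑ a, q h s a) := by
    rw [tsum_fintype, ENNReal.ofReal_sum_of_nonneg fun a _ => hq h s a]
  have h0 : 0 ≤ ∑ a, q h s a := Finset.sum_nonneg fun a _ => hq h s a
  unfold policyOf
  split_ifs with hz
  · rw [hsum, ENNReal.ofReal_eq_zero] at hz
    have hz' : ∑ a, q h s a = 0 := le_antisymm hz h0
    have := (Finset.sum_eq_zero_iff_of_nonneg fun a _ => hq h s a).1 hz' a (Finset.mem_univ a)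
    rw [hz', this, zero_mul]
  · have hne : ∑ a, q h s a ≠ 0 := fun h' => hz (by rw [hsum, h', ENNReal.ofReal_zero])
    rw [PMF.normalize_apply, hsum, ENNReal.toReal_mul, ENNReal.toReal_inv,
      ENNReal.toReal_ofReal h0, ENNReal.toReal_ofReal (hq h s a)]
    field_simp

/-- Every solution of the flow constraints is the occupancy measure of its own policy. -/
lemma IsFlow.occ_policyOf [Nonempty A] {H : ℕ} {p : Transition H S A} {s₀ : S}
    {q : StepFun H S A} (hq : IsFlow p s₀ q) : occ p s₀ (policyOf q) = q := by
  have ho := isFlow_occ p s₀ (policyOf q)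
  have key : ∀ (i : ℕ) (hi : i < H) (s : S) (a : A),
      occ p s₀ (policyOf q) ⟨i, hi⟩ s a = q ⟨i, hi⟩ s a := by
    intro i
    induction i with
    | zero =>
      intro hi s a
      rw [occ_eq_sum_mul, ho.init, ← hq.init hi, sum_mul_policyOf hq.nonneg]
    | succ i ih =>
      intro hi s a
      rw [occ_eq_sum_mul, ho.step]
      simp only [ih]
      rw [← hq.step, sum_mul_policyOf hq.nonneg]
  funext h s a
  exact key h h.2 s a

lemma mem_occSet_iff [Nonempty A] {H : ℕ} {p : Transition H S A} {s₀ : S}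
    {q : StepFun H S A} : q ∈ occSet p s₀ ↔ IsFlow p s₀ q := by
  constructor
  · rintro ⟨π, rfl⟩
    exact isFlow_occ p s₀ π
  · exact fun hq => ⟨policyOf q, hq.occ_policyOf⟩

lemma occ_policyOf_of_mem [Nonempty A] {H : ℕ} {p : Transition H S A} {s₀ : S}
    {q : StepFun H S A} (hq : q ∈ occSet p s₀) : occ p s₀ (policyOf q) = q :=
  (mem_occSet_iff.1 hq).occ_policyOf

omit [Fintype S] [Fintype A] in
lemma occSet_nonneg {H : ℕ} {p : Transition H S A} {s₀ : S} {q : StepFun H S A}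
    (hq : q ∈ occSet p s₀) (h : Fin H) (s : S) (a : A) : 0 ≤ q h s a := by
  obtain ⟨π, rfl⟩ := hq
  exact prob_nonneg _ _

lemma occSet_le_one {H : ℕ} {p : Transition H S A} {s₀ : S} {q : StepFun H S A}
    (hq : q ∈ occSet p s₀) (h : Fin H) (s : S) (a : A) : q h s a ≤ 1 := by
  obtain ⟨π, rfl⟩ := hq
  exact prob_le_one _ _

lemma occSet_sum_eq_one {H : ℕ} {p : Transition H S A} {s₀ : S} {q : StepFun H S A}
    (hq : q ∈ occSet p s₀) (h : Fin H) : ∑ s, ∑ a, q h s a = 1 := by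
  classical
  obtain ⟨π, rfl⟩ := hq
  simp only [occ_eq_expect, ← expect_sum, ← Fintype.sum_prod_type']
  simp [expect_const]

lemma isCompact_occSet [Nonempty A] {H : ℕ} (p : Transition H S A) (s₀ : S) :
    IsCompact (occSet p s₀) := by
  have hsub : occSet p s₀ ⊆ Set.univ.pi fun _ => Set.univ.pi fun _ => Set.univ.pi fun _ =>
      Set.Icc (0 : ℝ) 1 := fun q hq h _ s _ a _ => ⟨occSet_nonneg hq h s a, occSet_le_one hq h s a⟩
  refine IsCompact.of_isClosed_subset (isCompact_univ_pi fun _ => isCompact_univ_pi fun _ =>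
    isCompact_univ_pi fun _ => isCompact_Icc) ?_ hsub
  have heq : occSet p s₀ =
      {q | ∀ h s a, 0 ≤ q h s a} ∩
      ({q | ∀ (h0 : 0 < H) (s : S),
        ∑ a, q ⟨0, h0⟩ s a = Set.indicator {s₀} (fun _ => (1 : ℝ)) s} ∩
      {q | ∀ (i : ℕ) (hi : i + 1 < H) (s' : S), ∑ a, q ⟨i + 1, hi⟩ s' a =
        ∑ s, ∑ a, q ⟨i, Nat.lt_of_succ_lt hi⟩ s a *
          (p ⟨i, Nat.lt_of_succ_lt hi⟩ s a s').toReal}) := by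
    ext q
    rw [mem_occSet_iff]
    exact ⟨fun h => ⟨h.1, h.2, h.3⟩, fun h => ⟨h.1, h.2.1, h.2.2⟩⟩
  rw [heq]
  simp only [Set.ofPred_forall]
  refine .inter ?_ (.inter ?_ ?_)
  · exact isClosed_iInter fun h => isClosed_iInter fun s => isClosed_iInter fun a =>
      isClosed_le (by fun_prop) (by fun_prop)
  · exact isClosed_iInter fun h0 => isClosed_iInter fun s =>
      isClosed_eq (by fun_prop) (by fun_prop)
  · exact isClosed_iInter fun i => isClosed_iInter fun hi => isClosed_iInter fun s =>
      isClosed_eq (by fun_prop) (by fun_prop)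

lemma convex_occSet [Nonempty A] {H : ℕ} (p : Transition H S A) (s₀ : S) :
    Convex ℝ (occSet p s₀) := by
  intro x hx y hy α β hα hβ hαβ
  rw [mem_occSet_iff] at hx hy ⊢
  constructor
  · intro h s a
    exact add_nonneg (mul_nonneg hα (hx.nonneg h s a)) (mul_nonneg hβ (hy.nonneg h s a))
  · intro h0 s
    simp only [Pi.add_apply, Pi.smul_apply, smul_eq_mul, Finset.sum_add_distrib,
      ← Finset.mul_sum, hx.init, hy.init]
    rw [← add_mul, hαβ, one_mul]
  · intro i hi s'
    simp only [Pi.add_apply, Pi.smul_apply, smul_eq_mul, Finset.sum_add_distrib,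
      ← Finset.mul_sum, hx.step, hy.step, add_mul, mul_assoc]

lemma value_eq_pairing {H : ℕ} (p : Transition H S A) (s₀ : S) (c : StepFun H S A)
    (π : Policy H S A) : value p s₀ c π = pairing (occ p s₀ π) c := by
  classical
  change expect (trajLaw p π s₀) (fun τ => ∑ h, c h (τ h).1 (τ h).2) = _
  simp only [pairing, occ_eq_expect]
  rw [expect_sum]
  refine Finset.sum_congr rfl fun h _ => ?_
  simp only [mul_comm _ (c h _ _), ← expect_const_mul, ← expect_sum, ← Fintype.sum_prod_type']
  simp

open Classical in
/-- In an episode in which all agents independently play the same policy, a given pair is visited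
with probability `1 - (1 - q)^m`. -/
lemma expect_exists_visit {m H : ℕ} (p : Transition H S A) (s₀ : S) (π : Policy H S A)
    (h : Fin H) (s : S) (a : A) :
    expect (episodeLaw (m := m) p s₀ fun _ => π) (fun e => if ∃ v, e v h = (s, a) then 1 else 0) =
      visitProb m (occ p s₀ π) h s a := by
  have hind : ∀ e : TeamTraj m H S A,
      (if ∃ v, e v h = (s, a) then (1 : ℝ) else 0) =
        1 - ∏ v, (1 - if e v h = (s, a) then (1 : ℝ) else 0) := by
    intro e
    by_cases he : ∃ v, e v h = (s, a)
    · rw [if_pos he]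
      obtain ⟨v, hv⟩ := he
      rw [Finset.prod_eq_zero (Finset.mem_univ v) (by simp [hv]), sub_zero]
    · rw [if_neg he, Finset.prod_eq_one, sub_self]
      intro v _
      simp [not_exists.1 he v]
  simp only [hind]
  rw [expect_sub, expect_const, episodeLaw,
    expect_indepProd_prod _ fun _ (τ : Traj H S A) => 1 - if τ h = (s, a) then (1 : ℝ) else 0]
  simp only [expect_sub, expect_const, ← occ_eq_expect]
  simp [visitProb]

lemma prob_exists_visit {m H : ℕ} (p : Transition H S A) (s₀ : S) (π : Policy H S A) (h : Fin H)
    (s : S) (a : A) :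
    prob (episodeLaw (m := m) p s₀ fun _ => π) {e | ∃ v, e v h = (s, a)} =
      visitProb m (occ p s₀ π) h s a := by
  classical
  rw [← expect_exists_visit, prob_eq_expect]
  congr 1; ext e
  congr

end Occupancy

/-! ### Entropic mirror descent -/

section Entropy

variable {ι : Type*} [Fintype ι]

/-- The tangent inequality for `y log y`; the logarithm of the junk quotient `0 / x` is `0`. -/
lemma sub_le_mul_log_div {x y : ℝ} (hx : 0 ≤ x) (hy : 0 ≤ y) (hxy : x = 0 → y = 0) :
    y - x ≤ y * Real.log (y / x) := by
  rcases hy.eq_or_lt with rfl | hy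
  · simpa using hx
  have hx' : 0 < x := lt_of_le_of_ne hx fun h => hy.ne' (hxy h.symm)
  have h := Real.log_le_sub_one_of_pos (div_pos hx' hy)
  rw [← inv_div, Real.log_inv]
  have h2 : y * Real.log (x / y) ≤ y * (x / y - 1) := mul_le_mul_of_nonneg_left h hy.le
  have h3 : y * (x / y - 1) = x - y := by field_simp
  linarith

/-- Convexity of `z ↦ z log (z / r)`: its graph lies above the tangent at `z > 0`. -/
lemma tangent_le {r x z : ℝ} (hr : 0 < r) (hx : 0 ≤ x) (hz : 0 < z) :
    z * Real.log (z / r) + (x - z) * (Real.log (z / r) + 1) ≤ x * Real.log (x / r) := by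
  rcases hx.eq_or_lt with rfl | hx
  · simp only [zero_mul]
    nlinarith
  have h := sub_le_mul_log_div hz.le hx.le fun h => absurd h hz.ne'
  rw [Real.log_div hx.ne' hz.ne'] at h
  rw [Real.log_div hx.ne' hr.ne', Real.log_div hz.ne' hr.ne']
  nlinarith

/-- First-order optimality on a segment, in variational form: if `x` minimizes the regularized
objective on the segment from `x` to `y`, the gradient at every interior point of the segment has
nonnegative inner product with `y - x`. -/
lemma gradient_nonneg_of_segment_min {x y r l : ι → ℝ} (hx : ∀ i, 0 ≤ x i) (hy : ∀ i, 0 ≤ y i)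
    (hr : ∀ i, 0 ≤ r i) (hxr : ∀ i, r i = 0 → x i = 0) (hyr : ∀ i, r i = 0 → y i = 0)
    (hmass : ∑ i, x i = ∑ i, y i) {t : ℝ} (ht0 : 0 < t) (ht1 : t < 1)
    (hmin : ∑ i, (l i * x i + x i * Real.log (x i / r i)) ≤
      ∑ i, (l i * ((1 - t) * x i + t * y i) + ((1 - t) * x i + t * y i) *
        Real.log (((1 - t) * x i + t * y i) / r i))) :
    0 ≤ ∑ i, (y i - x i) * (l i + Real.log (((1 - t) * x i + t * y i) / r i)) := by
  have key : ∀ i, (l i * ((1 - t) * x i + t * y i) + ((1 - t) * x i + t * y i) *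
        Real.log (((1 - t) * x i + t * y i) / r i)) -
      t * ((y i - x i) * (l i + Real.log (((1 - t) * x i + t * y i) / r i)) + (y i - x i)) ≤
      l i * x i + x i * Real.log (x i / r i) := by
    intro i
    have hz0 : 0 ≤ (1 - t) * x i + t * y i :=
      add_nonneg (mul_nonneg (by linarith) (hx i)) (mul_nonneg ht0.le (hy i))
    rcases hz0.eq_or_lt with hz | hz
    · have hxi : x i = 0 := by nlinarith [hx i, hy i, mul_nonneg ht0.le (hy i)]
      have hyi : y i = 0 := by
        rw [hxi] at hz
        have : t * y i = 0 := by linarith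
        exact (mul_eq_zero.1 this).resolve_left ht0.ne'
      simp [hxi, hyi]
    · have hri : 0 < r i := lt_of_le_of_ne (hr i) fun h => by
        rw [hxr i h.symm, hyr i h.symm] at hz
        simp at hz
      have := tangent_le hri (hx i) hz
      linear_combination this
  have hsum := Finset.sum_le_sum fun i (_ : i ∈ Finset.univ) => key i
  rw [Finset.sum_sub_distrib, ← Finset.mul_sum, Finset.sum_add_distrib (g := fun i => y i - x i),
    Finset.sum_sub_distrib (f := y), hmass, sub_self, add_zero] at hsum
  have : 0 ≤ t * ∑ i, (y i - x i) * (l i + Real.log (((1 - t) * x i + t * y i) / r i)) := by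
    linarith
  exact nonneg_of_mul_nonneg_right this ht0

/-- First-order optimality for the relative entropy. Since the derivative of `z log z` at `0` is
`-∞`, a minimizer charges every coordinate that a competitor charges; hence the gradient at the
minimizer itself makes sense. -/
lemma first_order_of_segment_min {x y r l : ι → ℝ} (hx : ∀ i, 0 ≤ x i) (hy : ∀ i, 0 ≤ y i)
    (hr : ∀ i, 0 ≤ r i) (hxr : ∀ i, r i = 0 → x i = 0) (hyr : ∀ i, r i = 0 → y i = 0)
    (hmass : ∑ i, x i = ∑ i, y i)
    (hmin : ∀ t : ℝ, 0 < t → t < 1 → ∑ i, (l i * x i + x i * Real.log (x i / r i)) ≤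
      ∑ i, (l i * ((1 - t) * x i + t * y i) + ((1 - t) * x i + t * y i) *
        Real.log (((1 - t) * x i + t * y i) / r i))) :
    (∀ i, x i = 0 → y i = 0) ∧ 0 ≤ ∑ i, (y i - x i) * (l i + Real.log (x i / r i)) := by
  classical
  -- The singular part of the gradient is `Z log t`, where `Z` is the mass that `y` puts outside
  -- the support of `x`; what remains is continuous at `t = 0`.
  set G : ℝ → ℝ := fun t => ∑ i, if x i = 0 then y i * (l i + Real.log (y i / r i))
    else (y i - x i) * (l i + Real.log (((1 - t) * x i + t * y i) / r i)) with hG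
  set Z : ℝ := ∑ i, if x i = 0 then y i else 0 with hZ
  have hGZ : ∀ t : ℝ, 0 < t → t < 1 → 0 ≤ G t + Z * Real.log t := by
    intro t ht0 ht1
    refine (gradient_nonneg_of_segment_min hx hy hr hxr hyr hmass ht0 ht1
      (hmin t ht0 ht1)).trans_eq ?_
    rw [hG, hZ, Finset.sum_mul, ← Finset.sum_add_distrib]
    refine Finset.sum_congr rfl fun i _ => ?_
    split_ifs with hi
    · rw [hi, mul_zero, zero_add, sub_zero]
      by_cases hyi : y i = 0
      · simp [hyi]
      · have hri : r i ≠ 0 := fun h => hyi (hyr i h)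
        rw [mul_div_assoc, Real.log_mul ht0.ne' (div_ne_zero hyi hri)]
        ring
    · ring
  have hGlim : Filter.Tendsto G (nhdsWithin 0 (Set.Ioi 0)) (nhds (G 0)) := by
    refine Filter.Tendsto.mono_left ?_ nhdsWithin_le_nhds
    refine tendsto_finsetSum _ fun i _ => ?_
    split_ifs with hi
    · exact tendsto_const_nhds
    · have hri : r i ≠ 0 := fun h => hi (hxr i h)
      have hcont : ContinuousAt (fun t : ℝ => ((1 - t) * x i + t * y i) / r i) 0 := by fun_prop
      have hne : ((1 - (0 : ℝ)) * x i + 0 * y i) / r i ≠ 0 := by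
        simp [hi, hri]
      exact ((hcont.log hne).const_add (l i)).const_mul (y i - x i)
  have hev : ∀ᶠ t : ℝ in nhdsWithin 0 (Set.Ioi 0), 0 < t ∧ t < 1 :=
    Ioo_mem_nhdsGT one_pos
  have hZ0 : 0 ≤ Z := Finset.sum_nonneg fun i _ => by split_ifs; exacts [hy i, le_rfl]
  have hZz : Z = 0 := by
    by_contra hne
    have hZpos : 0 < Z := lt_of_le_of_ne hZ0 (Ne.symm hne)
    have hbot : Filter.Tendsto (fun t => G t + Z * Real.log t) (nhdsWithin 0 (Set.Ioi 0))
        Filter.atBot :=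
      hGlim.add_atBot (Real.tendsto_log_nhdsGT_zero.const_mul_atBot hZpos)
    obtain ⟨t, ⟨ht0, ht1⟩, ht⟩ := (hev.and (hbot.eventually_lt_atBot 0)).exists
    exact absurd (hGZ t ht0 ht1) (not_le.2 ht)
  have hxy : ∀ i, x i = 0 → y i = 0 := by
    intro i hi
    have := (Finset.sum_eq_zero_iff_of_nonneg fun i _ => by
      split_ifs; exacts [hy i, le_rfl]).1 hZz i (Finset.mem_univ i)
    simpa [hi] using this
  refine ⟨hxy, ?_⟩
  have h0 : 0 ≤ G 0 := by
    refine ge_of_tendsto hGlim ?_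
    filter_upwards [hev] with t ht
    simpa [hZz] using hGZ t ht.1 ht.2
  refine h0.trans_eq (Finset.sum_congr rfl fun i _ => ?_)
  split_ifs with hi
  · simp [hi, hxy i hi]
  · simp

lemma exp_neg_le {x : ℝ} (hx : 0 ≤ x) : Real.exp (-x) ≤ 1 - x + x ^ 2 := by
  rcases le_total x 1 with h | h
  · have := Real.abs_exp_sub_one_sub_id_le (x := -x) (by rw [abs_neg, abs_of_nonneg hx]; exact h)
    have := (abs_le.1 this).2
    nlinarith
  · have : Real.exp (-x) ≤ 1 := Real.exp_le_one_iff.2 (by linarith)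
    nlinarith

/-- One step of mirror descent, from the first-order condition: with `y` the competitor, `r` the
old and `x` the new iterate, the linearized regret is controlled by the decrease of the divergence
and a local-norm term. -/
lemma mirror_step {x y r l : ι → ℝ} (hx : ∀ i, 0 ≤ x i)
    (hr : ∀ i, 0 ≤ r i) (hl : ∀ i, 0 ≤ l i) (hxr : ∀ i, r i = 0 → x i = 0)
    (hxy : ∀ i, x i = 0 → y i = 0) (hmass : ∑ i, x i = ∑ i, r i)
    (hfo : 0 ≤ ∑ i, (y i - x i) * (l i + Real.log (x i / r i))) :
    ∑ i, (r i - y i) * l i ≤ ∑ i, y i * Real.log (y i / r i) - ∑ i, y i * Real.log (y i / x i) +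
      ∑ i, r i * l i ^ 2 := by
  have key : ∀ i, (r i - y i) * l i + (y i - x i) * (l i + Real.log (x i / r i)) + (x i - r i) ≤
      y i * Real.log (y i / r i) - y i * Real.log (y i / x i) + r i * l i ^ 2 := by
    intro i
    have hexp := exp_neg_le (hl i)
    have h1 : r i * Real.exp (-l i) ≤ r i * (1 - l i + l i ^ 2) :=
      mul_le_mul_of_nonneg_left hexp (hr i)
    -- Compare `x` with the unprojected exponential-weights update `r e^{-l}`.
    have h2 := sub_le_mul_log_div (mul_nonneg (hr i) (Real.exp_pos (-l i)).le) (hx i) fun h =>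
      hxr i ((mul_eq_zero.1 h).resolve_right (Real.exp_pos _).ne')
    rcases (hx i).eq_or_lt with hxi | hxi
    · rw [← hxi, hxy i hxi.symm]
      rw [← hxi] at h2
      simp at h2 ⊢
      nlinarith
    · have hri : r i ≠ 0 := fun h => hxi.ne' (hxr i h)
      have h3 : Real.log (x i / (r i * Real.exp (-l i))) = Real.log (x i / r i) + l i := by
        rw [← div_div, Real.log_div (div_ne_zero hxi.ne' hri) (Real.exp_pos _).ne', Real.log_exp]
        ring
      rw [h3] at h2
      by_cases hyi : y i = 0
      · rw [hyi]
        simp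
        nlinarith
      · have h4 : y i * Real.log (y i / r i) - y i * Real.log (y i / x i) =
            y i * Real.log (x i / r i) := by
          rw [Real.log_div hyi hri, Real.log_div hyi hxi.ne', Real.log_div hxi.ne' hri]
          ring
        rw [h4]
        nlinarith
  have hsum := Finset.sum_le_sum fun i (_ : i ∈ Finset.univ) => key i
  simp only [Finset.sum_add_distrib, Finset.sum_sub_distrib] at hsum hfo ⊢
  linarith

lemma sum_mul_log_nonneg {x y : ι → ℝ} (hx : ∀ i, 0 ≤ x i) (hy : ∀ i, 0 ≤ y i)
    (hxy : ∀ i, x i = 0 → y i = 0) (hmass : ∑ i, x i = ∑ i, y i) :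
    0 ≤ ∑ i, y i * Real.log (y i / x i) := by
  have := Finset.sum_le_sum fun i (_ : i ∈ Finset.univ) =>
    sub_le_mul_log_div (hx i) (hy i) (hxy i)
  rwa [Finset.sum_sub_distrib, hmass, sub_self] at this

end Entropy

section OMD

variable {H : ℕ} {S A : Type*} [Fintype S] [Fintype A] [Nonempty A]
  {p : Transition H S A} {s₀ : S} {η : ℝ} {chat r q : StepFun H S A}

omit [Nonempty A] in
lemma sum_triple (f : Fin H → S → A → ℝ) :
    ∑ h, ∑ s, ∑ a, f h s a = ∑ i : Fin H × S × A, f i.1 i.2.1 i.2.2 := by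
  rw [Fintype.sum_prod_type]
  exact Finset.sum_congr rfl fun h _ =>
    (Fintype.sum_prod_type fun j : S × A => f h j.1 j.2).symm

omit [Nonempty A] in
lemma continuous_klDiv (r : StepFun H S A) : Continuous fun q : StepFun H S A => klDiv q r := by
  unfold klDiv
  refine continuous_finsetSum _ fun h _ => continuous_finsetSum _ fun s _ =>
    continuous_finsetSum _ fun a _ => ?_
  by_cases hr : r h s a = 0
  -- Here `q / 0 = 0` makes the term vanish identically.
  · simp [hr, continuous_const]
  · have h1 : (fun q : StepFun H S A => q h s a * Real.log (q h s a / r h s a)) =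
        fun q => r h s a * ((q h s a / r h s a) * Real.log (q h s a / r h s a)) := by
      funext q
      field_simp
    rw [h1]
    exact continuous_const.mul (Real.continuous_mul_log.comp (by fun_prop))

lemma exists_isOMDStep (hne : ∃ q ∈ occSet p s₀, AbsCont q r) :
    ∃ q, IsOMDStep p s₀ η chat r q := by
  have hclosed : IsClosed {q : StepFun H S A | AbsCont q r} := by
    simp only [AbsCont, Set.ofPred_forall]
    exact isClosed_iInter fun h => isClosed_iInter fun s => isClosed_iInter fun a =>
      isClosed_iInter fun _ => isClosed_eq (by fun_prop) (by fun_prop)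
  have hcomp := (isCompact_occSet p s₀).inter_right hclosed
  have hcont : Continuous fun q : StepFun H S A => η * pairing q chat + klDiv q r := by
    refine Continuous.add ?_ (continuous_klDiv r)
    unfold pairing
    fun_prop
  obtain ⟨q₀, hq₀, hr₀⟩ := hne
  obtain ⟨q, hq, hmin⟩ := hcomp.exists_isMinOn ⟨q₀, hq₀, hr₀⟩ hcont.continuousOn
  exact ⟨q, hq, fun q' h1 h2 => hmin (a := q') ⟨h1, h2⟩⟩

lemma omdStep_spec (hne : ∃ q ∈ occSet p s₀, AbsCont q r) :
    IsOMDStep p s₀ η chat r (omdStep p s₀ η chat r) :=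
  Classical.epsilon_spec (exists_isOMDStep hne)

omit [Fintype S] in
lemma occSet_nonempty (p : Transition H S A) (s₀ : S) : (occSet p s₀).Nonempty :=
  ⟨occ p s₀ fun _ _ => PMF.uniformOfFintype A, Set.mem_range_self _⟩

omit [Nonempty A] in
lemma occSet_mass (hq : q ∈ occSet p s₀) : ∑ i : Fin H × S × A, q i.1 i.2.1 i.2.2 = H := by
  rw [← sum_triple q]
  simp [occSet_sum_eq_one hq]

/-- First-order optimality of a mirror descent step. -/
lemma IsOMDStep.first_order (hr0 : ∀ h s a, 0 ≤ r h s a) (hq : IsOMDStep p s₀ η chat r q)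
    {y : StepFun H S A} (hy : y ∈ occSet p s₀) (hyr : AbsCont y r) :
    AbsCont y q ∧ 0 ≤ ∑ i : Fin H × S × A, (y i.1 i.2.1 i.2.2 - q i.1 i.2.1 i.2.2) *
      (η * chat i.1 i.2.1 i.2.2 + Real.log (q i.1 i.2.1 i.2.2 / r i.1 i.2.1 i.2.2)) := by
  have hobj : ∀ z : StepFun H S A, η * pairing z chat + klDiv z r =
      ∑ i : Fin H × S × A, (η * chat i.1 i.2.1 i.2.2 * z i.1 i.2.1 i.2.2 +
        z i.1 i.2.1 i.2.2 * Real.log (z i.1 i.2.1 i.2.2 / r i.1 i.2.1 i.2.2)) := by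
    intro z
    rw [pairing, klDiv, sum_triple, sum_triple, Finset.mul_sum, ← Finset.sum_add_distrib]
    exact Finset.sum_congr rfl fun i _ => by ring
  obtain ⟨h1, h2⟩ := first_order_of_segment_min
    (x := fun i : Fin H × S × A => q i.1 i.2.1 i.2.2) (y := fun i => y i.1 i.2.1 i.2.2)
    (r := fun i => r i.1 i.2.1 i.2.2) (l := fun i => η * chat i.1 i.2.1 i.2.2)
    (fun i => occSet_nonneg hq.1.1 _ _ _) (fun i => occSet_nonneg hy _ _ _)
    (fun i => hr0 _ _ _) (fun i => hq.1.2 _ _ _) (fun i => hyr _ _ _)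
    ((occSet_mass hq.1.1).trans (occSet_mass hy).symm) (by
      intro t ht0 ht1
      have := hq.2 ((1 - t) • q + t • y)
        (convex_occSet p s₀ hq.1.1 hy (by linarith) ht0.le (by ring))
        (fun h s a h0 => by simp [hq.1.2 h s a h0, hyr h s a h0])
      rw [hobj, hobj] at this
      exact this)
  exact ⟨fun h s a => h1 (h, s, a), h2⟩

/-- The regret inequality of one mirror descent step on `Δ(M)`. -/
lemma IsOMDStep.regret_le (hη : 0 ≤ η) (hc : ∀ h s a, 0 ≤ chat h s a) (hr : r ∈ occSet p s₀)
    (hq : IsOMDStep p s₀ η chat r q) {y : StepFun H S A} (hy : y ∈ occSet p s₀)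
    (hyr : AbsCont y r) :
    η * (pairing r chat - pairing y chat) ≤ klDiv y r - klDiv y q +
      η ^ 2 * ∑ h, ∑ s, ∑ a, r h s a * chat h s a ^ 2 := by
  obtain ⟨h1, h2⟩ := hq.first_order (occSet_nonneg hr) hy hyr
  have h3 := mirror_step
    (x := fun i : Fin H × S × A => q i.1 i.2.1 i.2.2) (y := fun i => y i.1 i.2.1 i.2.2)
    (r := fun i => r i.1 i.2.1 i.2.2) (l := fun i => η * chat i.1 i.2.1 i.2.2)
    (fun i => occSet_nonneg hq.1.1 _ _ _)
    (fun i => occSet_nonneg hr _ _ _) (fun i => mul_nonneg hη (hc _ _ _))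
    (fun i => hq.1.2 _ _ _) (fun i => h1 _ _ _)
    ((occSet_mass hq.1.1).trans (occSet_mass hr).symm) h2
  simp only [pairing, klDiv, sum_triple, Finset.mul_sum] at h3 ⊢
  rw [← Finset.sum_sub_distrib, Finset.mul_sum]
  refine le_trans (le_of_eq ?_) (h3.trans_eq ?_)
  · exact Finset.sum_congr rfl fun i _ => by ring
  · congr 1
    exact Finset.sum_congr rfl fun i _ => by ring

omit [Nonempty A] in
lemma klDiv_nonneg (hr : r ∈ occSet p s₀) (hq : q ∈ occSet p s₀) (hqr : AbsCont q r) :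
    0 ≤ klDiv q r := by
  rw [klDiv, sum_triple]
  exact sum_mul_log_nonneg (fun i => occSet_nonneg hr _ _ _) (fun i => occSet_nonneg hq _ _ _)
    (fun i => hqr _ _ _) ((occSet_mass hr).trans (occSet_mass hq).symm)

/-- The divergence of any occupancy measure from the entropy-maximizing one is at most
`H log (S A)`, by the Pythagorean inequality. -/
lemma IsOMDStep.klDiv_le_of_uniform (hq : IsOMDStep p s₀ η (fun _ _ _ => 0)
      (fun _ _ _ => 1 / ((Fintype.card S : ℝ) * (Fintype.card A : ℝ))) q)
    {y : StepFun H S A} (hy : y ∈ occSet p s₀) :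
    AbsCont y q ∧ klDiv y q ≤ H * Real.log ((Fintype.card S : ℝ) * (Fintype.card A : ℝ)) := by
  have hS : (0 : ℝ) < Fintype.card S := by
    exact_mod_cast Fintype.card_pos_iff.2 ⟨s₀⟩
  have hA : (0 : ℝ) < Fintype.card A := by exact_mod_cast Fintype.card_pos
  set N : ℝ := (Fintype.card S : ℝ) * (Fintype.card A : ℝ) with hN
  have hNpos : 0 < N := mul_pos hS hA
  have hu : 0 < 1 / N := by positivity
  obtain ⟨h1, h2⟩ := hq.first_order (fun _ _ _ => hu.le) hy (fun _ _ _ h => absurd h hu.ne')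
  refine ⟨h1, ?_⟩
  -- With zero losses the mirror descent inequality is the Pythagorean inequality.
  have h3 := mirror_step
    (x := fun i : Fin H × S × A => q i.1 i.2.1 i.2.2) (y := fun i => y i.1 i.2.1 i.2.2)
    (r := fun _ => 1 / N) (l := fun i => η * 0)
    (fun i => occSet_nonneg hq.1.1 _ _ _)
    (fun i => hu.le) (fun i => by simp)
    (fun i h => absurd h hu.ne') (fun i => h1 _ _ _)
    ((occSet_mass hq.1.1).trans (by simp [hN]; field_simp)) h2
  simp only [mul_zero, Finset.sum_const_zero] at h3
  rw [klDiv, sum_triple]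
  have h4 : ∑ i : Fin H × S × A, y i.1 i.2.1 i.2.2 * Real.log (y i.1 i.2.1 i.2.2 / (1 / N)) ≤
      ∑ i : Fin H × S × A, y i.1 i.2.1 i.2.2 * Real.log N := by
    refine Finset.sum_le_sum fun i _ => ?_
    have hy0 := occSet_nonneg hy i.1 i.2.1 i.2.2
    rcases hy0.eq_or_lt with h | h
    · simp [← h]
    · refine mul_le_mul_of_nonneg_left (Real.log_le_log (div_pos h hu) ?_) hy0
      rw [div_div_eq_mul_div, div_one]
      exact mul_le_of_le_one_left hNpos.le (occSet_le_one hy _ _ _)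
  rw [← Finset.sum_mul, occSet_mass hy] at h4
  simp at h3 h4
  linarith

end OMD

/-! ### The visit estimator -/

section Estimator

lemma visitProb_nonneg {H : ℕ} {S A : Type*} {m : ℕ} {q : StepFun H S A} {h : Fin H} {s : S}
    {a : A} (h0 : 0 ≤ q h s a) (h1 : q h s a ≤ 1) : 0 ≤ visitProb m q h s a :=
  sub_nonneg.2 (pow_le_one₀ (by linarith) (by linarith))

/-- The key comparison of a single agent's visit probability with the team's: the ratio `q / W` is
at most `1 / m + q`. -/
lemma le_mul_visitProb {H : ℕ} {S A : Type*} {m : ℕ} (hm : 1 ≤ m) {q : StepFun H S A}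
    {h : Fin H} {s : S} {a : A} (h0 : 0 ≤ q h s a) (h1 : q h s a ≤ 1) :
    q h s a ≤ (1 / m + q h s a) * visitProb m q h s a := by
  have hm' : (0 : ℝ) < m := by exact_mod_cast hm
  rw [visitProb]
  generalize q h s a = x at *
  -- Bernoulli: `(1 - x)^m (1 + m x) ≤ (1 - x)^m (1 + x)^m ≤ 1`.
  have hB : (1 - x) ^ m * (1 + m * x) ≤ 1 :=
    calc (1 - x) ^ m * (1 + m * x) ≤ (1 - x) ^ m * (1 + x) ^ m :=
          mul_le_mul_of_nonneg_left (one_add_mul_le_pow (by linarith) m)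
            (pow_nonneg (by linarith) m)
      _ = (1 - x ^ 2) ^ m := by rw [← mul_pow]; ring
      _ ≤ 1 := pow_le_one₀ (by nlinarith) (by nlinarith)
  have h2 : (1 / (m : ℝ) + x) * (1 - (1 - x) ^ m) - x =
      (1 - (1 - x) ^ m * (1 + m * x)) / m := by
    field_simp
    ring
  have h3 : 0 ≤ (1 - (1 - x) ^ m * (1 + m * x)) / m := div_nonneg (by linarith) hm'.le
  linarith

lemma div_visitProb_le {H : ℕ} {S A : Type*} {m : ℕ} (hm : 1 ≤ m) {γ : ℝ} (hγ : 0 < γ)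
    {q : StepFun H S A} {h : Fin H} {s : S} {a : A} (h0 : 0 ≤ q h s a) (h1 : q h s a ≤ 1) :
    q h s a / (visitProb m q h s a + γ) ≤ 1 / m + q h s a := by
  have hw := visitProb_nonneg (m := m) h0 h1
  rw [div_le_iff₀ (by linarith)]
  refine (le_mul_visitProb hm h0 h1).trans (mul_le_mul_of_nonneg_left (by linarith) ?_)
  positivity

variable {m H : ℕ} {S A : Type*} {γ : ℝ} {q c : StepFun H S A}

lemma estimator_nonneg (hγ : 0 < γ) (hq : ∀ h s a, q h s a ∈ Set.Icc (0 : ℝ) 1)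
    (hc : ∀ h s a, c h s a ∈ Set.Icc (0 : ℝ) 1) (e : TeamTraj m H S A) (h : Fin H) (s : S)
    (a : A) : 0 ≤ estimator γ q c e h s a := by
  have hw := visitProb_nonneg (m := m) (hq h s a).1 (hq h s a).2
  refine div_nonneg (mul_nonneg (hc h s a).1 ?_) (by linarith)
  split_ifs <;> norm_num

open Classical in
lemma mul_estimator_le (hm : 1 ≤ m) (hγ : 0 < γ) (hq : ∀ h s a, q h s a ∈ Set.Icc (0 : ℝ) 1)
    (hc : ∀ h s a, c h s a ∈ Set.Icc (0 : ℝ) 1) (e : TeamTraj m H S A) (h : Fin H) (s : S)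
    (a : A) :
    q h s a * estimator γ q c e h s a ≤
      (1 / m + q h s a) * (if ∃ v, e v h = (s, a) then 1 else 0) := by
  have h1 := div_visitProb_le hm hγ (hq h s a).1 (hq h s a).2
  have h2 : (0 : ℝ) ≤ 1 / m + q h s a := add_nonneg (by positivity) (hq h s a).1
  have h3 := hc h s a
  unfold estimator
  split_ifs with hv
  · rw [mul_one, mul_one, mul_div_assoc', mul_comm, mul_div_assoc]
    calc c h s a * (q h s a / (visitProb m q h s a + γ))
        ≤ 1 * (1 / m + q h s a) := mul_le_mul h3.2 h1 (div_nonneg (hq h s a).1 (by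
          linarith [visitProb_nonneg (m := m) (hq h s a).1 (hq h s a).2])) zero_le_one
      _ = _ := one_mul _
  · simp

lemma mul_estimator_sq_le (hm : 1 ≤ m) (hγ : 0 < γ)
    (hq : ∀ h s a, q h s a ∈ Set.Icc (0 : ℝ) 1) (hc : ∀ h s a, c h s a ∈ Set.Icc (0 : ℝ) 1)
    (e : TeamTraj m H S A) (h : Fin H) (s : S) (a : A) :
    q h s a * estimator γ q c e h s a ^ 2 ≤
      1 / m * estimator γ q c e h s a + q h s a * estimator γ q c e h s a := by
  classical
  have h1 := mul_estimator_le hm hγ hq hc e h s a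
  have h0 := estimator_nonneg hγ hq hc e h s a
  have h2 : (0 : ℝ) ≤ 1 / m + q h s a := add_nonneg (by positivity) (hq h s a).1
  have h3 : q h s a * estimator γ q c e h s a ≤ 1 / m + q h s a := by
    refine h1.trans (mul_le_of_le_one_right h2 ?_)
    split_ifs <;> norm_num
  nlinarith

variable [Fintype S] [Fintype A]

/-- The learner's estimated loss is bounded surely: at each step at most `m` pairs are visited,
and each of them contributes at most `1 / m + q`. -/
lemma pairing_estimator_le (hm : 1 ≤ m) (hγ : 0 < γ)
    (hq : ∀ h s a, q h s a ∈ Set.Icc (0 : ℝ) 1) (hmass : ∀ h, ∑ s, ∑ a, q h s a = 1)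
    (hc : ∀ h s a, c h s a ∈ Set.Icc (0 : ℝ) 1) (e : TeamTraj m H S A) :
    pairing q (estimator γ q c e) ≤ 2 * H := by
  classical
  have hm' : (0 : ℝ) < m := by exact_mod_cast hm
  have hstep : ∀ h, ∑ s, ∑ a, q h s a * estimator γ q c e h s a ≤ 2 := by
    intro h
    calc ∑ s, ∑ a, q h s a * estimator γ q c e h s a
        ≤ ∑ s, ∑ a, (1 / m * (∑ v, if e v h = (s, a) then (1 : ℝ) else 0) + q h s a) := by
          refine Finset.sum_le_sum fun s _ => Finset.sum_le_sum fun a _ => ?_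
          refine (mul_estimator_le hm hγ hq hc e h s a).trans ?_
          have hnn : ∀ v ∈ Finset.univ, (0 : ℝ) ≤ if e v h = (s, a) then 1 else 0 := fun v _ => by
            split_ifs <;> norm_num
          have hcount : (if ∃ v, e v h = (s, a) then (1 : ℝ) else 0) ≤
              ∑ v, if e v h = (s, a) then (1 : ℝ) else 0 := by
            split_ifs with hv
            · obtain ⟨v, hv⟩ := hv
              have := Finset.single_le_sum hnn (Finset.mem_univ v)
              simpa only [hv, if_true] using this
            · exact Finset.sum_nonneg hnn
          have hi1 : (if ∃ v, e v h = (s, a) then (1 : ℝ) else 0) ≤ 1 := by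
            split_ifs <;> norm_num
          rw [add_mul]
          exact add_le_add (mul_le_mul_of_nonneg_left hcount (by positivity))
            (mul_le_of_le_one_right (hq h s a).1 hi1)
      _ = 2 := by
          have : ∑ s, ∑ a, ∑ v, (if e v h = (s, a) then (1 : ℝ) else 0) = m := by
            rw [← Fintype.sum_prod_type' fun s a => ∑ v, (if e v h = (s, a) then (1 : ℝ) else 0),
              Finset.sum_comm]
            simp
          simp only [Finset.sum_add_distrib, ← Finset.mul_sum, hmass, this]
          field_simp
          norm_num
  calc pairing q (estimator γ q c e) ≤ ∑ _h : Fin H, (2 : ℝ) :=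
        Finset.sum_le_sum fun h _ => hstep h
    _ = 2 * H := by simp [mul_comm]

lemma pairing_nonneg {q c : StepFun H S A} (hq : ∀ h s a, 0 ≤ q h s a)
    (hc : ∀ h s a, 0 ≤ c h s a) : 0 ≤ pairing q c :=
  Finset.sum_nonneg fun h _ => Finset.sum_nonneg fun s _ => Finset.sum_nonneg fun a _ =>
    mul_nonneg (hq h s a) (hc h s a)

/-- The conditional mean of the estimator. -/
noncomputable def meanEstimator (m : ℕ) (γ : ℝ) (q c : StepFun H S A) : StepFun H S A :=
  fun h s a => c h s a * visitProb m q h s a / (visitProb m q h s a + γ)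

variable {p : Transition H S A} {s₀ : S} {π : Policy H S A}

lemma expect_estimator (hπ : occ p s₀ π = q) (h : Fin H) (s : S) (a : A) :
    expect (episodeLaw (m := m) p s₀ fun _ => π) (fun e => estimator γ q c e h s a) =
      meanEstimator m γ q c h s a := by
  classical
  have h1 := expect_exists_visit (m := m) p s₀ π h s a
  rw [hπ] at h1
  unfold meanEstimator
  nth_rewrite 1 [← h1]
  rw [mul_comm (c h s a), mul_div_assoc, mul_comm, ← expect_const_mul]
  congr 1; ext e
  unfold estimator
  ring_nf

lemma expect_pairing_estimator (hπ : occ p s₀ π = q) :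
    expect (episodeLaw (m := m) p s₀ fun _ => π) (fun e => pairing q (estimator γ q c e)) =
      pairing q (meanEstimator m γ q c) := by
  simp only [pairing, expect_sum, expect_const_mul, expect_estimator hπ]

/-- The bias of implicit exploration. -/
lemma pairing_sub_meanEstimator_le (hm : 1 ≤ m) (hγ : 0 < γ)
    (hq : ∀ h s a, q h s a ∈ Set.Icc (0 : ℝ) 1) (hmass : ∀ h, ∑ s, ∑ a, q h s a = 1)
    (hc : ∀ h s a, c h s a ∈ Set.Icc (0 : ℝ) 1) :
    pairing q c - pairing q (meanEstimator m γ q c) ≤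
      γ * (H * (1 + (Fintype.card S : ℝ) * Fintype.card A / m)) := by
  simp only [pairing, ← Finset.sum_sub_distrib]
  calc ∑ h, ∑ s, ∑ a, (q h s a * c h s a - q h s a * meanEstimator m γ q c h s a)
      ≤ ∑ h, ∑ s, ∑ a, γ * (1 / m + q h s a) := by
        refine Finset.sum_le_sum fun h _ => Finset.sum_le_sum fun s _ =>
          Finset.sum_le_sum fun a _ => ?_
        have h0 := visitProb_nonneg (m := m) (hq h s a).1 (hq h s a).2
        have h1 := div_visitProb_le hm hγ (hq h s a).1 (hq h s a).2
        have h2 : 0 ≤ q h s a / (visitProb m q h s a + γ) :=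
          div_nonneg (hq h s a).1 (by linarith)
        have h3 : q h s a * c h s a - q h s a * meanEstimator m γ q c h s a =
            γ * (c h s a * (q h s a / (visitProb m q h s a + γ))) := by
          have : visitProb m q h s a + γ ≠ 0 := by linarith
          unfold meanEstimator
          field_simp
          ring
        rw [h3]
        exact mul_le_mul_of_nonneg_left
          ((mul_le_of_le_one_left h2 (hc h s a).2).trans h1) hγ.le
    _ = γ * (H * (1 + (Fintype.card S : ℝ) * Fintype.card A / m)) := by
        simp only [← Finset.mul_sum, Finset.sum_add_distrib, hmass, Finset.sum_const,
          Finset.card_univ, Fintype.card_fin, nsmul_eq_mul]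
        ring

/-- Implicit exploration makes `exp (γ ĉ)` at most `exp (γ c)` in conditional expectation. -/
lemma expect_exp_estimator_le (hγ : 0 < γ)
    (hq : ∀ h s a, q h s a ∈ Set.Icc (0 : ℝ) 1) (hc : ∀ h s a, c h s a ∈ Set.Icc (0 : ℝ) 1)
    (hπ : occ p s₀ π = q) (h : Fin H) (s : S) (a : A) :
    expect (episodeLaw (m := m) p s₀ fun _ => π)
      (fun e => Real.exp (γ * estimator γ q c e h s a - γ * c h s a)) ≤ 1 := by
  classical
  have hw := visitProb_nonneg (m := m) (hq h s a).1 (hq h s a).2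
  have hcc := hc h s a
  have hvisit := expect_exists_visit (m := m) p s₀ π h s a
  rw [hπ] at hvisit
  set w := visitProb m q h s a with hwdef
  set y := γ * c h s a / (w + γ) with hy
  have hwγ : 0 < w + γ := by linarith
  have hy0 : 0 ≤ y := div_nonneg (mul_nonneg hγ.le hcc.1) hwγ.le
  have hy1 : y ≤ 1 := by
    rw [hy, div_le_one hwγ]
    nlinarith [hcc.2]
  have hexp : Real.exp y ≤ 1 + (y + y ^ 2) := by
    have := (abs_le.1 (Real.abs_exp_sub_one_sub_id_le (x := y) (by rwa [abs_of_nonneg hy0]))).2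
    linarith
  have hpt : ∀ e : TeamTraj m H S A,
      Real.exp (γ * estimator γ q c e h s a - γ * c h s a) ≤
        Real.exp (-(γ * c h s a)) *
          (1 + (y + y ^ 2) * (if ∃ v, e v h = (s, a) then 1 else 0)) := by
    intro e
    rw [sub_eq_neg_add, Real.exp_add]
    refine mul_le_mul_of_nonneg_left ?_ (Real.exp_pos _).le
    unfold estimator
    split_ifs with hv
    · rw [mul_one, mul_one, ← mul_div_assoc]
      exact hexp
    · simp
  refine (expect_mono _ hpt).trans ?_
  rw [expect_const_mul, expect_add, expect_const, expect_const_mul, hvisit]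
  -- This amounts to `w (w + 2 γ) ≤ (w + γ)²`, using `c ≤ 1`.
  have hmain : (y + y ^ 2) * w ≤ γ * c h s a := by
    have h1 : (y + y ^ 2) * w = γ * c h s a * (w * (w + γ + γ * c h s a) / (w + γ) ^ 2) := by
      rw [hy]
      field_simp
    rw [h1]
    refine mul_le_of_le_one_right (mul_nonneg hγ.le hcc.1) ?_
    rw [div_le_one (by positivity)]
    nlinarith [mul_le_mul_of_nonneg_left hcc.2 (mul_nonneg hw hγ.le), sq_nonneg γ]
  calc Real.exp (-(γ * c h s a)) * (1 + (y + y ^ 2) * w)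
      ≤ Real.exp (-(γ * c h s a)) * Real.exp (γ * c h s a) := by
        refine mul_le_mul_of_nonneg_left ?_ (Real.exp_pos _).le
        linarith [Real.add_one_le_exp (γ * c h s a)]
    _ = 1 := by rw [← Real.exp_add, neg_add_cancel, Real.exp_zero]

end Estimator

/-! ### Exponential supermartingales along a run -/

/-- An exponential lower-tail bound for a variable with values in `[0, B]`, from
`exp (-x) ≤ 1 - x + x²` for `x ≥ 0`. -/
lemma expect_exp_mean_sub_le {α : Type*} [Fintype α] (P : PMF α) {X : α → ℝ} {B t : ℝ}
    (ht : 0 ≤ t) (hX0 : ∀ x, 0 ≤ X x) (hXB : ∀ x, X x ≤ B) :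
    expect P (fun x => Real.exp (t * expect P X - t * X x - t ^ 2 * B ^ 2)) ≤ 1 := by
  have hpt : ∀ x, Real.exp (t * expect P X - t * X x - t ^ 2 * B ^ 2) ≤
      Real.exp (t * expect P X - t ^ 2 * B ^ 2) * (1 + t ^ 2 * B ^ 2 - t * X x) := by
    intro x
    rw [show t * expect P X - t * X x - t ^ 2 * B ^ 2 =
      (t * expect P X - t ^ 2 * B ^ 2) + -(t * X x) by ring, Real.exp_add]
    refine mul_le_mul_of_nonneg_left ?_ (Real.exp_pos _).le
    have h1 := exp_neg_le (mul_nonneg ht (hX0 x))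
    have h2 : (t * X x) ^ 2 ≤ (t * B) ^ 2 :=
      pow_le_pow_left₀ (mul_nonneg ht (hX0 x)) (mul_le_mul_of_nonneg_left (hXB x) ht) 2
    nlinarith
  refine (expect_mono P hpt).trans ?_
  rw [expect_const_mul, expect_sub, expect_const, expect_const_mul]
  set u := t * expect P X - t ^ 2 * B ^ 2 with hu
  calc Real.exp u * (1 + t ^ 2 * B ^ 2 - t * expect P X) ≤ Real.exp u * Real.exp (-u) := by
        refine mul_le_mul_of_nonneg_left ?_ (Real.exp_pos _).le
        linarith [Real.add_one_le_exp (-u)]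
    _ = 1 := by rw [← Real.exp_add, add_neg_cancel, Real.exp_zero]

section Run

variable {m H : ℕ} {S A : Type*} [Fintype S] [Fintype A] {p : Transition H S A} {s₀ : S}

/-- The episodes before episode `k` of a run of `K` episodes. -/
def past {T : Type*} {K : ℕ} (hist : Fin K → T) (k : Fin K) : Fin k → T :=
  fun j => hist (Fin.castLE k.isLt.le j)

/-- If the conditional expectation of `exp (Y k)` given the past is at most `1` in every episode,
then so is the expectation of the exponential of the sum. -/
lemma expect_exp_sum_le_one (alg : TeamAlg m H S A)
    (Y : (k : ℕ) → (Fin k → TeamTraj m H S A) → TeamTraj m H S A → ℝ) (K : ℕ)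
    (hY : ∀ k < K, ∀ hist, expect (episodeLaw p s₀ (alg k hist))
      (fun e => Real.exp (Y k hist e)) ≤ 1) :
    expect (runLaw p s₀ alg K)
      (fun hist => Real.exp (∑ k : Fin K, Y k (past hist k) (hist k))) ≤ 1 := by
  induction K with
  | zero => simp [expect_const]
  | succ K ih =>
    refine le_trans ?_ (ih fun k hk => hY k (by omega))
    simp only [runLaw, expect_bind, expect_map]
    refine expect_mono _ fun hist => ?_
    have hpast : ∀ (e : TeamTraj m H S A) (k : Fin K),
        past (Fin.snoc (α := fun _ => TeamTraj m H S A) hist e) k.castSucc = past hist k := by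
      intro e k
      funext j
      exact Fin.snoc_castSucc (α := fun _ => TeamTraj m H S A) e hist (Fin.castLE k.isLt.le j)
    have hlast : ∀ e : TeamTraj m H S A,
        past (Fin.snoc (α := fun _ => TeamTraj m H S A) hist e) (Fin.last K) = hist := by
      intro e
      funext j
      exact Fin.snoc_castSucc (α := fun _ => TeamTraj m H S A) e hist j
    have hstep : ∀ e : TeamTraj m H S A,
        Real.exp (∑ k : Fin (K + 1),
          Y k (past (Fin.snoc (α := fun _ => TeamTraj m H S A) hist e) k)
            (Fin.snoc (α := fun _ => TeamTraj m H S A) hist e k)) =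
        Real.exp (∑ k : Fin K, Y k (past hist k) (hist k)) * Real.exp (Y K hist e) := by
      intro e
      rw [← Real.exp_add, Fin.sum_univ_castSucc]
      congr 2
      · refine Finset.sum_congr rfl fun k _ => ?_
        rw [hpast, Fin.snoc_castSucc]
        rfl
      · rw [Fin.snoc_last]
        exact congrArg (fun g => Y K g e) (hlast e)
    simp only [hstep]
    rw [expect_const_mul]
    exact mul_le_of_le_one_right (Real.exp_pos _).le (hY K (by omega) hist)

end Run

/-! ### The regret of coop-O-REPS -/

section Regret

variable {m H : ℕ} {S A : Type*} [Fintype S] [Fintype A] [Nonempty A]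
  (p : Transition H S A) (s₀ : S) (c : ℕ → StepFun H S A) (η γ : ℝ)

lemma orepsIterate_zero_spec (hist : Fin 0 → TeamTraj m H S A) :
    IsOMDStep p s₀ η (fun _ _ _ => 0)
      (fun _ _ _ => 1 / ((Fintype.card S : ℝ) * (Fintype.card A : ℝ)))
      (orepsIterate p s₀ c η γ 0 hist) := by
  obtain ⟨q, hq⟩ := occSet_nonempty p s₀
  refine omdStep_spec ⟨q, hq, fun h s a h0 => absurd h0 ?_⟩
  have hS : (Fintype.card S : ℝ) ≠ 0 := by
    exact_mod_cast (Fintype.card_pos_iff.2 ⟨s₀⟩).ne'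
  have hA : (Fintype.card A : ℝ) ≠ 0 := by exact_mod_cast Fintype.card_pos.ne'
  exact one_div_ne_zero (mul_ne_zero hS hA)

lemma orepsIterate_mem (k : ℕ) (hist : Fin k → TeamTraj m H S A) :
    orepsIterate p s₀ c η γ k hist ∈ occSet p s₀ := by
  induction k with
  | zero => exact (orepsIterate_zero_spec p s₀ c η γ hist).1.1
  | succ k ih =>
    exact (omdStep_spec ⟨_, ih fun j => hist j.castSucc, fun _ _ _ h => h⟩).1.1

lemma orepsIterate_succ_spec (k : ℕ) (hist : Fin (k + 1) → TeamTraj m H S A) :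
    IsOMDStep p s₀ η
      (estimator γ (orepsIterate p s₀ c η γ k fun j => hist j.castSucc) (c k)
        (hist (Fin.last k)))
      (orepsIterate p s₀ c η γ k fun j => hist j.castSucc)
      (orepsIterate p s₀ c η γ (k + 1) hist) :=
  omdStep_spec ⟨_, orepsIterate_mem p s₀ c η γ k _, fun _ _ _ h => h⟩

lemma orepsIterate_mem_Icc (k : ℕ) (hist : Fin k → TeamTraj m H S A) (h : Fin H) (s : S) (a : A) :
    orepsIterate p s₀ c η γ k hist h s a ∈ Set.Icc (0 : ℝ) 1 :=
  ⟨occSet_nonneg (orepsIterate_mem p s₀ c η γ k hist) h s a,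
    occSet_le_one (orepsIterate_mem p s₀ c η γ k hist) h s a⟩

/-- The estimated cost of episode `k` in a run. -/
noncomputable def runEstimate {K : ℕ} (hist : Fin K → TeamTraj m H S A) (k : Fin K) :
    StepFun H S A :=
  estimator γ (orepsIterate p s₀ c η γ k (past hist k)) (c k) (hist k)

/-- The regret of mirror descent against the estimated costs. -/
lemma orepsIterate_regret_le (hη : 0 ≤ η) (hγ : 0 < γ) {y : StepFun H S A}
    (hy : y ∈ occSet p s₀) (K : ℕ) (hc : ∀ k < K, ∀ h s a, c k h s a ∈ Set.Icc (0 : ℝ) 1)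
    (hist : Fin K → TeamTraj m H S A) :
    AbsCont y (orepsIterate p s₀ c η γ K hist) ∧
    ∑ k : Fin K, η * (pairing (orepsIterate p s₀ c η γ k (past hist k))
        (runEstimate p s₀ c η γ hist k) - pairing y (runEstimate p s₀ c η γ hist k)) ≤
      H * Real.log ((Fintype.card S : ℝ) * Fintype.card A)
        - klDiv y (orepsIterate p s₀ c η γ K hist)
        + ∑ k : Fin K, η ^ 2 * ∑ h, ∑ s, ∑ a,
          orepsIterate p s₀ c η γ k (past hist k) h s a *
            runEstimate p s₀ c η γ hist k h s a ^ 2 := by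
  induction K with
  | zero =>
    obtain ⟨h1, h2⟩ := (orepsIterate_zero_spec p s₀ c η γ hist).klDiv_le_of_uniform hy
    refine ⟨h1, ?_⟩
    simpa using h2
  | succ K ih =>
    obtain ⟨h1, h2⟩ := ih (fun k hk => hc k (by omega)) fun j => hist j.castSucc
    have hspec := orepsIterate_succ_spec p s₀ c η γ K hist
    have hmem := orepsIterate_mem p s₀ c η γ K fun j => hist j.castSucc
    have hest := estimator_nonneg hγ
      (orepsIterate_mem_Icc p s₀ c η γ K fun j => hist j.castSucc) (hc K (by omega))
      (hist (Fin.last K))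
    refine ⟨(hspec.first_order (occSet_nonneg hmem) hy h1).1, ?_⟩
    have h3 := hspec.regret_le hη hest hmem hy h1
    rw [Fin.sum_univ_castSucc, Fin.sum_univ_castSucc]
    have h4 := add_le_add h2 h3
    refine le_trans (le_of_eq ?_) (h4.trans (le_of_eq ?_))
    · rfl
    · have e1 : (∑ k : Fin K, η ^ 2 * ∑ h, ∑ s, ∑ a,
          orepsIterate p s₀ c η γ k (past (fun j : Fin K => hist j.castSucc) k) h s a *
            runEstimate p s₀ c η γ (fun j : Fin K => hist j.castSucc) k h s a ^ 2) =
          ∑ k : Fin K, η ^ 2 * ∑ h, ∑ s, ∑ a,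
          orepsIterate p s₀ c η γ k.castSucc (past hist k.castSucc) h s a *
            runEstimate p s₀ c η γ hist k.castSucc h s a ^ 2 := rfl
      have e2 : (η ^ 2 * ∑ h, ∑ s, ∑ a,
          orepsIterate p s₀ c η γ K (fun j => hist j.castSucc) h s a *
            estimator γ (orepsIterate p s₀ c η γ K fun j => hist j.castSucc) (c K)
              (hist (Fin.last K)) h s a ^ 2) =
          η ^ 2 * ∑ h, ∑ s, ∑ a,
          orepsIterate p s₀ c η γ (Fin.last K) (past hist (Fin.last K)) h s a *
            runEstimate p s₀ c η γ hist (Fin.last K) h s a ^ 2 := rfl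
      rw [e1, e2]
      ring

end Regret

/-! ### Concentration and tuning -/

section Combine

variable {m H : ℕ} {S A : Type*} [Fintype S] [Fintype A] [Nonempty A]
  (p : Transition H S A) (s₀ : S) (c : ℕ → StepFun H S A) (η γ : ℝ)

omit [Nonempty A] in
lemma sum_pairing_comm {K : ℕ} (y : StepFun H S A) (f : Fin K → StepFun H S A) :
    ∑ k, pairing y (f k) = ∑ h, ∑ s, ∑ a, y h s a * ∑ k, f k h s a := by
  simp only [pairing, Finset.mul_sum]
  rw [Finset.sum_comm]
  refine Finset.sum_congr rfl fun h _ => ?_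
  rw [Finset.sum_comm]
  refine Finset.sum_congr rfl fun s _ => ?_
  rw [Finset.sum_comm]

/-- The regret against a fixed occupancy measure on the event where the two concentration
inequalities hold: `ĉ` does not exceed `c` by much, pair by pair, and the learner's estimated loss
does not fall much below its conditional mean. -/
lemma regret_le_of_concentration (hm : 1 ≤ m) {K : ℕ} (hη : 0 < η) (hγ : 0 < γ)
    (hc : ∀ k < K, ∀ h s a, c k h s a ∈ Set.Icc (0 : ℝ) 1) (hist : Fin K → TeamTraj m H S A)
    {t b : ℝ} (ht : 0 < t)
    (hpair : ∀ h s a, ∑ k : Fin K,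
      (γ * runEstimate p s₀ c η γ hist k h s a - γ * c k h s a) ≤ b)
    (hloss : ∑ k : Fin K,
      (t * pairing (orepsIterate p s₀ c η γ k (past hist k))
          (meanEstimator m γ (orepsIterate p s₀ c η γ k (past hist k)) (c k)) -
        t * pairing (orepsIterate p s₀ c η γ k (past hist k)) (runEstimate p s₀ c η γ hist k) -
        t ^ 2 * (2 * H) ^ 2) ≤ b)
    {y : StepFun H S A} (hy : y ∈ occSet p s₀) :
    ∑ k : Fin K, pairing (orepsIterate p s₀ c η γ k (past hist k)) (c k) ≤
      ∑ k : Fin K, pairing y (c k) +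
        (K * (γ * (H * (1 + (Fintype.card S : ℝ) * Fintype.card A / m))) +
        (b / t + K * (t * (2 * H) ^ 2)) +
        H * Real.log ((Fintype.card S : ℝ) * Fintype.card A) / η +
        η * (1 / m * (H * Fintype.card S * Fintype.card A * (K + b / γ)) + 2 * H * K) +
        H * (b / γ)) := by
  set q : Fin K → StepFun H S A := fun k => orepsIterate p s₀ c η γ k (past hist k) with hq
  set est : Fin K → StepFun H S A := fun k => runEstimate p s₀ c η γ hist k with hest
  have hqI : ∀ k h s a, q k h s a ∈ Set.Icc (0 : ℝ) 1 := fun k =>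
    orepsIterate_mem_Icc p s₀ c η γ k _
  have hqm : ∀ k h, ∑ s, ∑ a, q k h s a = 1 := fun k =>
    occSet_sum_eq_one (orepsIterate_mem p s₀ c η γ k _)
  have hcost : ∀ k : Fin K, ∀ h s a, c k h s a ∈ Set.Icc (0 : ℝ) 1 := fun k => hc k k.2
  have hbias : ∑ k, pairing (q k) (c k) ≤ ∑ k, pairing (q k) (meanEstimator m γ (q k) (c k)) +
      K * (γ * (H * (1 + (Fintype.card S : ℝ) * Fintype.card A / m))) := by
    have := Finset.sum_le_sum fun k (_ : k ∈ Finset.univ) =>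
      pairing_sub_meanEstimator_le hm hγ (hqI k) (hqm k) (hcost k)
    rw [Finset.sum_sub_distrib, Finset.sum_const, Finset.card_univ, Fintype.card_fin,
      nsmul_eq_mul] at this
    linarith
  have hmart : ∑ k, pairing (q k) (meanEstimator m γ (q k) (c k)) ≤
      ∑ k, pairing (q k) (est k) + (b / t + K * (t * (2 * H) ^ 2)) := by
    rw [Finset.sum_sub_distrib, Finset.sum_sub_distrib, ← Finset.mul_sum, ← Finset.mul_sum,
      Finset.sum_const, Finset.card_univ, Fintype.card_fin, nsmul_eq_mul] at hloss
    have h1 : b / t + K * (t * (2 * H) ^ 2) = (b + K * (t ^ 2 * (2 * H) ^ 2)) / t := by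
      field_simp
    rw [h1, ← sub_le_iff_le_add', le_div_iff₀ ht]
    linarith
  have hsum_est : ∀ h s a, ∑ k, est k h s a ≤ ∑ k : Fin K, c k h s a + b / γ := by
    intro h s a
    have := hpair h s a
    rw [Finset.sum_sub_distrib, ← Finset.mul_sum, ← Finset.mul_sum, ← mul_sub] at this
    rw [← sub_le_iff_le_add', le_div_iff₀ hγ]
    linarith
  have hcomp : ∑ k, pairing y (est k) ≤ ∑ k : Fin K, pairing y (c k) + H * (b / γ) := by
    rw [sum_pairing_comm, sum_pairing_comm y fun k : Fin K => c k]
    calc ∑ h, ∑ s, ∑ a, y h s a * ∑ k, est k h s a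
        ≤ ∑ h, ∑ s, ∑ a, (y h s a * ∑ k : Fin K, c k h s a + y h s a * (b / γ)) := by
          refine Finset.sum_le_sum fun h _ => Finset.sum_le_sum fun s _ =>
            Finset.sum_le_sum fun a _ => ?_
          rw [← mul_add]
          exact mul_le_mul_of_nonneg_left (hsum_est h s a) (occSet_nonneg hy h s a)
      _ = _ := by
          simp only [Finset.sum_add_distrib, ← Finset.sum_mul, occSet_sum_eq_one hy]
          simp
  have hsq : ∑ k, ∑ h, ∑ s, ∑ a, q k h s a * est k h s a ^ 2 ≤
      1 / m * (H * Fintype.card S * Fintype.card A * (K + b / γ)) + 2 * H * K := by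
    have h1 : ∑ k, ∑ h, ∑ s, ∑ a, q k h s a * est k h s a ^ 2 ≤
        ∑ k, (1 / m * ∑ h, ∑ s, ∑ a, est k h s a + 2 * H) := by
      refine Finset.sum_le_sum fun k _ => ?_
      have hle := pairing_estimator_le hm hγ (hqI k) (hqm k) (hcost k) (hist k)
      refine le_trans ?_ (add_le_add le_rfl hle)
      simp only [pairing, Finset.mul_sum, ← Finset.sum_add_distrib]
      exact Finset.sum_le_sum fun h _ => Finset.sum_le_sum fun s _ =>
        Finset.sum_le_sum fun a _ => mul_estimator_sq_le hm hγ (hqI k) (hcost k) (hist k) h s a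
    refine h1.trans ?_
    rw [Finset.sum_add_distrib, ← Finset.mul_sum, Finset.sum_const, Finset.card_univ,
      Fintype.card_fin, nsmul_eq_mul, mul_comm (K : ℝ)]
    have h2 : ∑ k, ∑ h, ∑ s, ∑ a, est k h s a = ∑ h, ∑ s, ∑ a, ∑ k, est k h s a := by
      have := sum_pairing_comm (fun _ _ _ => (1 : ℝ)) est
      simpa only [pairing, one_mul] using this
    have h3 : ∑ h, ∑ s, ∑ a, ∑ k, est k h s a ≤
        H * Fintype.card S * Fintype.card A * (K + b / γ) := by
      calc ∑ h, ∑ s, ∑ a, ∑ k, est k h s a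
          ≤ ∑ _h : Fin H, ∑ _s : S, ∑ _a : A, ((K : ℝ) + b / γ) := by
            refine Finset.sum_le_sum fun h _ => Finset.sum_le_sum fun s _ =>
              Finset.sum_le_sum fun a _ => (hsum_est h s a).trans ?_
            have : ∑ k : Fin K, c k h s a ≤ ∑ _k : Fin K, (1 : ℝ) :=
              Finset.sum_le_sum fun k _ => (hcost k h s a).2
            simp only [Finset.sum_const, Finset.card_univ, Fintype.card_fin, nsmul_eq_mul,
              mul_one] at this
            linarith
        _ = _ := by
            simp only [Finset.sum_const, Finset.card_univ, Fintype.card_fin, nsmul_eq_mul]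
            ring
    rw [h2]
    exact add_le_add (mul_le_mul_of_nonneg_left h3 (by positivity)) le_rfl
  have hreg : ∑ k, pairing (q k) (est k) ≤ ∑ k, pairing y (est k) +
      (H * Real.log ((Fintype.card S : ℝ) * Fintype.card A) / η +
        η * (1 / m * (H * Fintype.card S * Fintype.card A * (K + b / γ)) + 2 * H * K)) := by
    obtain ⟨habs, h1⟩ := orepsIterate_regret_le p s₀ c η γ hη.le hγ hy K hc hist
    have h2 := klDiv_nonneg (orepsIterate_mem p s₀ c η γ K hist) hy habs
    have h3 : η * (∑ k, pairing (q k) (est k) - ∑ k, pairing y (est k)) ≤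
        H * Real.log ((Fintype.card S : ℝ) * Fintype.card A) +
        η ^ 2 * ∑ k, ∑ h, ∑ s, ∑ a, q k h s a * est k h s a ^ 2 := by
      rw [← Finset.sum_sub_distrib, Finset.mul_sum, Finset.mul_sum]
      linarith
    have h4 := mul_le_mul_of_nonneg_left hsq (sq_nonneg η)
    rw [← sub_le_iff_le_add']
    refine le_of_mul_le_mul_left ?_ hη
    refine (h3.trans (add_le_add_right h4 _)).trans_eq ?_
    field_simp
  linarith

/-- The bound of `regret_le_of_concentration` at the prescribed step size. Here `x = S A / m`,
`L` is the logarithmic factor, and `t` is the scale of the exponential moment. -/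
lemma tuned_bound_le {H K x L LS η : ℝ} (hH : 0 < H) (hK : 0 < K) (hx : 0 ≤ x) (hL : 0 < L)
    (hLS : LS ≤ L) (hη : η = Real.sqrt (L / ((1 + x) * K))) {t b : ℝ}
    (ht : t = Real.sqrt (L / K) / H) (hb : b ≤ 2 * L) :
    K * (η * (H * (1 + x))) + (b / t + K * (t * (2 * H) ^ 2)) + H * LS / η +
        η * (H * x * (K + b / η) + 2 * H * K) + H * (b / η) ≤
      13 * (H * Real.sqrt (K * L) + Real.sqrt (H ^ 2 * x * K * L) + H * x * L) := by
  have hx1 : 0 < 1 + x := by linarith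
  have hηpos : 0 < η := by rw [hη]; exact Real.sqrt_pos.2 (by positivity)
  have hηsq : η ^ 2 * ((1 + x) * K) = L := by
    rw [hη, Real.sq_sqrt (by positivity)]
    field_simp
  have hupos : 0 < Real.sqrt (L / K) := Real.sqrt_pos.2 (by positivity)
  have husq : Real.sqrt (L / K) ^ 2 * K = L := by
    rw [Real.sq_sqrt (by positivity)]
    field_simp
  set u := Real.sqrt (L / K) with hu
  have htpos : 0 < t := by rw [ht]; positivity
  set D := η * ((1 + x) * K) with hD
  have hLη : L / η = D := by rw [div_eq_iff hηpos.ne', hD, ← hηsq]; ring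
  have hU : Real.sqrt (K * L) = u * K := by
    rw [Real.sqrt_eq_iff_mul_self_eq (by positivity) (by positivity), ← husq]
    ring
  have hηK : η * K ≤ u * K := by
    refine mul_le_mul_of_nonneg_right ?_ hK.le
    rw [hη, hu]
    refine Real.sqrt_le_sqrt (div_le_div_of_nonneg_left hL.le hK ?_)
    nlinarith
  have hηKx : η * K * x ≤ D := by rw [hD]; nlinarith [mul_pos hηpos hK]
  have hLt : L / t = H * (u * K) := by
    rw [ht, div_div_eq_mul_div, div_eq_iff hupos.ne', ← husq]
    ring
  have htK : K * (t * (2 * H) ^ 2) = 4 * (H * (u * K)) := by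
    rw [ht]
    field_simp
    ring
  have hDle : H * D ≤ H * (u * K) + Real.sqrt (H ^ 2 * x * K * L) := by
    refine abs_le_of_sq_le_sq' ?_ (by positivity) |>.2
    have h1 : (H * D) ^ 2 = H ^ 2 * (K * L) + H ^ 2 * x * K * L := by
      rw [hD]
      linear_combination (H ^ 2 * ((1 + x) * K)) * hηsq
    have h2 : (H * (u * K)) ^ 2 = H ^ 2 * (K * L) := by
      rw [← husq]
      ring
    have h3 : Real.sqrt (H ^ 2 * x * K * L) ^ 2 = H ^ 2 * x * K * L :=
      Real.sq_sqrt (by positivity)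
    have h4 : 0 ≤ H * (u * K) * Real.sqrt (H ^ 2 * x * K * L) := by positivity
    nlinarith
  have hbη : b / η ≤ 2 * D := by
    rw [← hLη, ← mul_div_assoc]
    exact div_le_div_of_nonneg_right hb hηpos.le
  have hbt : b / t ≤ 2 * (H * (u * K)) := by
    rw [← hLt, ← mul_div_assoc]
    exact div_le_div_of_nonneg_right hb htpos.le
  have hLSη : H * LS / η ≤ H * D := by
    rw [← hLη, ← mul_div_assoc]
    exact div_le_div_of_nonneg_right (mul_le_mul_of_nonneg_left hLS hH.le) hηpos.le
  have e1 : K * (η * (H * (1 + x))) = H * D := by rw [hD]; ring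
  have e2 : η * (H * x * (K + b / η) + 2 * H * K) =
      H * (η * K * x) + H * x * b + 2 * (H * (η * K)) := by
    field_simp
  have e3 := mul_le_mul_of_nonneg_left hηKx hH.le
  have e4 := mul_le_mul_of_nonneg_left hηK hH.le
  have e5 := mul_le_mul_of_nonneg_left hb (mul_nonneg hH.le hx)
  have e6 := mul_le_mul_of_nonneg_left hbη hH.le
  have e7 : 0 ≤ H * x * L := by positivity
  have e8 := Real.sqrt_nonneg (H ^ 2 * x * K * L)
  rw [e1, e2, htK, hU]
  linarith

lemma regret_eq {K : ℕ} (hist : Fin K → TeamTraj m H S A) (v : Fin m) :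
    regret p s₀ c (coopOREPS p s₀ c η γ) hist v =
      ∑ k : Fin K, pairing (orepsIterate p s₀ c η γ k (past hist k)) (c k) -
        ⨅ π : Policy H S A, ∑ k : Fin K, pairing (occ p s₀ π) (c k) := by
  unfold regret
  simp only [value_eq_pairing]
  congr 1
  refine Finset.sum_congr rfl fun k _ => ?_
  have : occ p s₀ (played (coopOREPS p s₀ c η γ) hist v k) =
      orepsIterate p s₀ c η γ k (past hist k) :=
    occ_policyOf_of_mem (orepsIterate_mem p s₀ c η γ k (past hist k))
  rw [this]

/-- With a single action there is only one policy, and nothing to regret. -/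
lemma regret_eq_zero_of_card_eq_one (hA : Fintype.card A = 1) {K : ℕ} (alg : TeamAlg m H S A)
    (hist : Fin K → TeamTraj m H S A) (v : Fin m) : regret p s₀ c alg hist v = 0 := by
  have hsub : Subsingleton A := Fintype.card_le_one_iff_subsingleton.1 hA.le
  have hpmf : ∀ P Q : PMF A, P = Q := by
    intro P Q
    ext a
    have h1 : ∀ R : PMF A, R a = 1 := by
      intro R
      have := R.tsum_coe
      rwa [tsum_fintype, Fintype.sum_subsingleton _ a] at this
    rw [h1, h1]
  have hpol : ∀ π π' : Policy H S A, π = π' := fun π π' => by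
    funext h s
    exact hpmf _ _
  obtain ⟨π⟩ : Nonempty (Policy H S A) := ⟨fun _ _ => PMF.uniformOfFintype A⟩
  have : Nonempty (Policy H S A) := ⟨π⟩
  unfold regret
  have h1 : ∀ π' : Policy H S A, ∑ k : Fin K, value p s₀ (c k) π' =
      ∑ k : Fin K, value p s₀ (c k) π := fun π' => by rw [hpol π' π]
  simp only [h1, ciInf_const]
  rw [sub_eq_zero]
  exact Finset.sum_congr rfl fun k _ => by rw [hpol (played alg hist v k) π]

/-- Both families of concentration inequalities hold simultaneously with high probability. -/
lemma one_sub_le_prob_concentration (hm : 1 ≤ m) {K : ℕ} (hγ : 0 < γ)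
    (hc : ∀ k < K, ∀ h s a, c k h s a ∈ Set.Icc (0 : ℝ) 1) {t b : ℝ} (ht : 0 ≤ t)
    (G : Set (Fin K → TeamTraj m H S A))
    (hG : ∀ hist : Fin K → TeamTraj m H S A,
      (∀ h s a, ∑ k : Fin K,
        (γ * runEstimate p s₀ c η γ hist k h s a - γ * c k h s a) ≤ b) →
      ∑ k : Fin K,
        (t * pairing (orepsIterate p s₀ c η γ k (past hist k))
            (meanEstimator m γ (orepsIterate p s₀ c η γ k (past hist k)) (c k)) -
          t * pairing (orepsIterate p s₀ c η γ k (past hist k)) (runEstimate p s₀ c η γ hist k) -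
          t ^ 2 * (2 * H) ^ 2) ≤ b → hist ∈ G) :
    1 - ((H : ℝ) * Fintype.card S * Fintype.card A + 1) * Real.exp (-b) ≤
      prob (runLaw p s₀ (coopOREPS (m := m) p s₀ c η γ) K) G := by
  set P := runLaw p s₀ (coopOREPS (m := m) p s₀ c η γ) K with hP
  -- The bad events: one for each pair, and one for the learner's loss.
  let Y : Option (Fin H × S × A) → (k : ℕ) → (Fin k → TeamTraj m H S A) → TeamTraj m H S A → ℝ :=
    fun o k prev e => match o with
      | some i => γ * estimator γ (orepsIterate p s₀ c η γ k prev) (c k) e i.1 i.2.1 i.2.2 -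
          γ * c k i.1 i.2.1 i.2.2
      | none => t * pairing (orepsIterate p s₀ c η γ k prev)
            (meanEstimator m γ (orepsIterate p s₀ c η γ k prev) (c k)) -
          t * pairing (orepsIterate p s₀ c η γ k prev)
            (estimator γ (orepsIterate p s₀ c η γ k prev) (c k) e) -
          t ^ 2 * (2 * H) ^ 2
  let Z : Option (Fin H × S × A) → (Fin K → TeamTraj m H S A) → ℝ :=
    fun o hist => ∑ k : Fin K, Y o k (past hist k) (hist k)
  have hY : ∀ o, ∀ k < K, ∀ prev : Fin k → TeamTraj m H S A,
      expect (episodeLaw p s₀ (coopOREPS (m := m) p s₀ c η γ k prev))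
        (fun e => Real.exp (Y o k prev e)) ≤ 1 := by
    intro o k hk prev
    have hmem := orepsIterate_mem p s₀ c η γ k prev
    have hocc := occ_policyOf_of_mem hmem
    have hI := orepsIterate_mem_Icc p s₀ c η γ k prev
    cases o with
    | some i => exact expect_exp_estimator_le hγ hI (hc k hk) hocc i.1 i.2.1 i.2.2
    | none =>
      have hpos : ∀ e : TeamTraj m H S A, 0 ≤ pairing (orepsIterate p s₀ c η γ k prev)
          (estimator γ (orepsIterate p s₀ c η γ k prev) (c k) e) := fun e =>
        pairing_nonneg (occSet_nonneg hmem) (estimator_nonneg hγ hI (hc k hk) e)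
      have := expect_exp_mean_sub_le
        (episodeLaw (m := m) p s₀ fun _ => policyOf (orepsIterate p s₀ c η γ k prev)) ht hpos
        (pairing_estimator_le hm hγ hI (occSet_sum_eq_one hmem) (hc k hk))
      rw [expect_pairing_estimator hocc] at this
      exact this
  have hcover : ∀ hist, hist ∉ G → ∃ o, hist ∈ {hist | b < Z o hist} := by
    intro hist hnot
    by_contra! hcon
    refine hnot (hG hist (fun h s a => ?_) ?_)
    · exact not_lt.1 (hcon (some (h, s, a)))
    · exact not_lt.1 (hcon none)
  refine le_trans ?_ (one_sub_sum_prob_le P G _ hcover)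
  have hsum : ∑ o, prob P {hist | b < Z o hist} ≤
      ∑ _o : Option (Fin H × S × A), Real.exp (-b) :=
    Finset.sum_le_sum fun o _ => prob_lt_le_exp_neg P (Z o) b
      (expect_exp_sum_le_one _ (Y o) K (hY o))
  have hcard : ∑ _o : Option (Fin H × S × A), Real.exp (-b) =
      ((H : ℝ) * Fintype.card S * Fintype.card A + 1) * Real.exp (-b) := by
    simp [Fintype.card_option, mul_assoc]
  linarith

end Combine

end CoopMDP

open CoopMDP in
theorem mainTheorem2 :
    ∃ C : ℝ, 0 < C ∧
      ∀ (S A : Type*) [Fintype S] [Fintype A] [Nonempty A] (H m K : ℕ)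
        (p : Transition H S A) (s₀ : S) (c : ℕ → StepFun H S A) (δ η γ : ℝ),
        1 ≤ H → 1 ≤ m → 1 ≤ K → 0 < δ → δ < 1 →
        (∀ k < K, ∀ h s a, c k h s a ∈ Set.Icc (0 : ℝ) 1) →
        η = Real.sqrt (Real.log ((H : ℝ) * Fintype.card S * Fintype.card A / δ) /
          ((1 + (Fintype.card S : ℝ) * Fintype.card A / m) * K)) →
        γ = η →
        (∀ k < K, ∀ (hist : Fin k → TeamTraj m H S A) (h : Fin H) (s : S) (a : A),
          prob (episodeLaw p s₀ (coopOREPS (m := m) p s₀ c η γ k hist))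
              {e | ∃ v, e v h = (s, a)} =
            visitProb m (orepsIterate p s₀ c η γ k hist) h s a) ∧
        1 - δ ≤ prob (runLaw p s₀ (coopOREPS (m := m) p s₀ c η γ) K)
          {hist | ∀ v : Fin m,
            regret p s₀ c (coopOREPS p s₀ c η γ) hist v ≤
              C * (H * Real.sqrt (K * Real.log ((H : ℝ) * Fintype.card S * Fintype.card A / δ))
                + Real.sqrt ((H : ℝ) ^ 2 * Fintype.card S * Fintype.card A * K / m *
                    Real.log ((H : ℝ) * Fintype.card S * Fintype.card A / δ))
                + (H : ℝ) * Fintype.card S * Fintype.card A / m *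
                    Real.log ((H : ℝ) * Fintype.card S * Fintype.card A / δ))} := by
  refine ⟨13, by norm_num, ?_⟩
  intro S A _ _ _ H m K p s₀ c δ η γ hH hm hK hδ0 hδ1 hc hη hγη
  refine ⟨fun k _ hist h s a => ?_, ?_⟩
  · have h1 := prob_exists_visit (m := m) p s₀ (policyOf (orepsIterate p s₀ c η γ k hist)) h s a
    rw [occ_policyOf_of_mem (orepsIterate_mem p s₀ c η γ k hist)] at h1
    exact h1
  have hHr : (1 : ℝ) ≤ H := by exact_mod_cast hH
  have hmr : (1 : ℝ) ≤ m := by exact_mod_cast hm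
  have hKr : (1 : ℝ) ≤ K := by exact_mod_cast hK
  have hSr : (1 : ℝ) ≤ Fintype.card S := by
    exact_mod_cast Fintype.card_pos_iff.2 ⟨s₀⟩
  have hAr : (1 : ℝ) ≤ Fintype.card A := by
    exact_mod_cast (Fintype.card_pos : 0 < Fintype.card A)
  set N : ℝ := (H : ℝ) * Fintype.card S * Fintype.card A with hN
  have hHS : (1 : ℝ) ≤ (H : ℝ) * Fintype.card S := one_le_mul_of_one_le_of_one_le hHr hSr
  have hN1 : 1 ≤ N := one_le_mul_of_one_le_of_one_le hHS hAr
  have hL : 0 < Real.log (N / δ) := Real.log_pos (by rw [lt_div_iff₀ hδ0]; linarith)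
  set L := Real.log (N / δ) with hLdef
  -- The constant in `log (2 H S A / δ) ≤ 2 log (H S A / δ)` needs `H S A ≥ 2`; the single-action
  -- case is trivial.
  rcases (Nat.succ_le_of_lt (Fintype.card_pos : 0 < Fintype.card A)).eq_or_lt with hA1 | hA2
  · refine (by linarith : 1 - δ ≤ 1).trans ?_
    rw [← prob_univ (runLaw p s₀ (coopOREPS (m := m) p s₀ c η γ) K)]
    refine le_of_eq (congrArg _ (Set.eq_univ_of_forall fun hist v => ?_).symm)
    rw [regret_eq_zero_of_card_eq_one p s₀ c hA1.symm]
    positivity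
  have hA2' : (2 : ℝ) ≤ Fintype.card A := by exact_mod_cast hA2
  have hN2 : 2 ≤ N := by
    calc (2 : ℝ) = 1 * 2 := by norm_num
      _ ≤ N := mul_le_mul hHS hA2' (by norm_num) (by linarith)
  set b := Real.log (2 * N / δ) with hb
  have hb2 : b ≤ 2 * L := by
    have h1 : b ≤ Real.log (N / δ * (N / δ)) := by
      refine Real.log_le_log (by positivity) ?_
      rw [mul_div_assoc]
      refine mul_le_mul_of_nonneg_right ?_ (by positivity)
      rw [le_div_iff₀ hδ0]
      nlinarith
    rw [Real.log_mul (by positivity) (by positivity)] at h1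
    linarith
  have hexpb : (N + 1) * Real.exp (-b) ≤ δ := by
    rw [hb, Real.exp_neg, Real.exp_log (by positivity), inv_div, mul_div_assoc',
      div_le_iff₀ (by positivity)]
    nlinarith
  have hηpos : 0 < η := by rw [hη]; exact Real.sqrt_pos.2 (by positivity)
  subst hγη
  have htpos : 0 < Real.sqrt (L / K) / H :=
    div_pos (Real.sqrt_pos.2 (by positivity)) (by linarith)
  have hLS : Real.log ((Fintype.card S : ℝ) * Fintype.card A) ≤ L := by
    refine Real.log_le_log (by positivity) ?_
    rw [le_div_iff₀ hδ0, hN, mul_assoc]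
    have : (0 : ℝ) < (Fintype.card S : ℝ) * Fintype.card A := by positivity
    nlinarith
  refine le_trans (by linarith)
    (one_sub_le_prob_concentration p s₀ c γ γ hm hηpos hc htpos.le (b := b) _ ?_)
  intro hist hpair hloss v
  rw [regret_eq, sub_le_comm]
  have : Nonempty (Policy H S A) := ⟨fun _ _ => PMF.uniformOfFintype A⟩
  refine le_ciInf fun π => ?_
  have hreg := regret_le_of_concentration p s₀ c γ γ hm hηpos hηpos hc hist htpos hpair hloss
    (Set.mem_range_self π : occ p s₀ π ∈ occSet p s₀)
  have htune := tuned_bound_le (H := H) (K := K) (x := (Fintype.card S : ℝ) * Fintype.card A / m)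
    (by linarith) (by linarith) (by positivity) hL hLS hη rfl hb2
  have e1 : (1 / (m : ℝ)) * (N * (K + b / γ)) =
      H * ((Fintype.card S : ℝ) * Fintype.card A / m) * (K + b / γ) := by
    rw [hN]; ring
  have e2 : (H : ℝ) ^ 2 * Fintype.card S * Fintype.card A * K / m * L =
      (H : ℝ) ^ 2 * ((Fintype.card S : ℝ) * Fintype.card A / m) * K * L := by ring
  have e3 : N / m * L = H * ((Fintype.card S : ℝ) * Fintype.card A / m) * L := by rw [hN]; ring
  rw [e1] at hreg
  rw [e2, e3]
  linarith
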